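/- Let $n\ge 0$ and let $F_n$ be the free group of rank $n$. A subgroup $A\le F_n$ is a free factor if there is a subgroup $K\le F_n$ such that the natural map $A\ast K\to F_n$ is an isomorphism. A partial decomposition of $F_n$ is a non-empty finite set $d=\{A_1,\dots,A_k\}$ of non-trivial proper free factors such that the natural map $A_1\ast\cdots\ast A_k\to F_n$ is injective with image a free factor; it is a full decomposition if moreover $A_1,\dots,A_k$ generate $F_n$. Let $\operatorname{PD}(F_n)$ be the poset of partial decompositions of $F_n$ ordered by refinement ($c\le d$ if every $A\in c$ is contained in some $B\in d$), and let $\operatorname{D}(F_n)$ be its subposet of full decompositions. Let $\operatorname{FC}_n$ be the set of non-trivial proper free factors of $F_n$. A non-empty set $d$ of non-trivial proper free factors is basis compatible if there is a basis of $F_n$ such that every $A\in d$ is generated by a subset of this basis. Let $$\operatorname{FCD}_n=\{(A,d)\in \operatorname{FC}_n\times \operatorname{D}(F_n) : \{A\}\cup d \text{ is basis compatible}\}\cup\{(A,\emptyset) : A\in\operatorname{FC}_n\}\cup\{(F_n,d): d\in \operatorname{D}(F_n)\},$$ ordered by $(A,d)\le (B,e)$ if and only if $A\supseteq B$ and $d\le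 e$ in the refinement order, where $\emptyset$ is a unique minimal element below all full decompositions. For a poset $X$, let $\operatorname{sd}X$ be the poset of finite non-empty chains of $X$ ordered by inclusion. The group $\operatorname{Aut}(F_n)$ acts on all these posets through its action on subgroups of $F_n$. A poset is viewed as a topological space via the geometric realization of its order complex. Theorem. There is an $\operatorname{Aut}(F_n)$-equivariant order-preserving map $\varphi:\operatorname{sd}\operatorname{PD}(F_n)\to\operatorname{FCD}_n$ that is a homotopy equivalence, i.e. the continuous map that $\varphi$ induces between the geometric realizations of the order complexes is a homotopy equivalence. -/

import Mathlib

open scoped Pointwise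
open PartialOrder

noncomputable section

/-! ### Geometric realization of the order complex of a poset -/

/-- A point of the geometric realization of the order complex of the poset `P`: barycentric
coordinates, that is, a finitely supported family of nonnegative real weights with sum `1` on the
elements of `P` whose support is a chain. -/
@[ext]
structure OrderComplex (P : Type*) [PartialOrder P] where
  /-- the barycentric coordinates -/
  weight : P →₀ ℝ
  nonneg : ∀ p, 0 ≤ weight p
  sum_eq_one : (weight.sum fun _ r => r) = 1
  isChain : IsChain (· ≤ ·) (weight.support : Set P)

namespace OrderComplex

variable {P Q : Type*} [PartialOrder P] [PartialOrder Q]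

/-- The inclusion of the closed simplex spanned by a nonempty finite chain `c` of `P`. -/
def simplex (c : NonemptyFiniteChains P) (v : stdSimplex ℝ c.finset) : OrderComplex P where
  weight := (Finsupp.equivFunOnFinite.symm v.1).embDomain (Function.Embedding.subtype _)
  nonneg p := by
    classical
    by_cases hp : p ∈ c.finset
    · have h := Finsupp.embDomain_apply_self (Function.Embedding.subtype (· ∈ c.finset))
        (Finsupp.equivFunOnFinite.symm v.1) ⟨p, hp⟩
      have h0 := v.2.1 ⟨p, hp⟩
      simp only [Function.Embedding.subtype_apply] at h
      rw [h]
      simpa using h0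
    · rw [Finsupp.embDomain_of_notMem_range]
      simpa using hp
  sum_eq_one := by
    rw [Finsupp.sum_embDomain, Finsupp.sum_fintype _ _ (fun _ => rfl)]
    simpa using v.2.2
  isChain := by
    intro a ha b hb _
    simp only [Finsupp.support_embDomain, Finset.coe_map, Set.mem_image,
      Function.Embedding.subtype_apply] at ha hb
    obtain ⟨a, -, rfl⟩ := ha
    obtain ⟨b, -, rfl⟩ := hb
    exact c.comparable a b

/-- The weak topology: a set is open if and only if its preimage in every closed simplex
(with its Euclidean topology) is open. -/
instance : TopologicalSpace (OrderComplex P) :=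
  ⨆ c : NonemptyFiniteChains P, TopologicalSpace.coinduced (simplex c) inferInstance

theorem continuous_simplex (c : NonemptyFiniteChains P) : Continuous (simplex c) :=
  continuous_iSup_rng (i := c) continuous_coinduced_rng

theorem continuous_dom_iff {X : Type*} [TopologicalSpace X] {f : OrderComplex P → X} :
    Continuous f ↔ ∀ c : NonemptyFiniteChains P, Continuous (f ∘ simplex c) := by
  rw [continuous_iSup_dom]
  simp only [continuous_coinduced_dom]

/-- The map of realizations induced by an order-preserving map `f`: it is affine on every simplex
and sends the vertex `p` to the vertex `f p`. -/
def mapFun (f : P →o Q) (x : OrderComplex P) : OrderComplex Q where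
  weight := x.weight.mapDomain f
  nonneg q := by
    classical
    rw [Finsupp.mapDomain, Finsupp.sum_apply]
    refine Finset.sum_nonneg fun p _ => ?_
    show 0 ≤ (Finsupp.single (f p) (x.weight p)) q
    rw [Finsupp.single_apply]
    split_ifs
    · exact x.nonneg p
    · exact le_rfl
  sum_eq_one := by
    rw [Finsupp.sum_mapDomain_index (fun _ => rfl) (fun _ _ _ => rfl)]
    exact x.sum_eq_one
  isChain := by
    classical
    have h : (x.weight.mapDomain f).support ⊆ x.weight.support.image f :=
      Finsupp.mapDomain_support
    intro a ha b hb _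
    obtain ⟨a, ha2, rfl⟩ := Finset.mem_image.1 (h ha)
    obtain ⟨b, hb2, rfl⟩ := Finset.mem_image.1 (h hb)
    rcases x.isChain.total ha2 hb2 with hab | hab
    · exact Or.inl (f.monotone hab)
    · exact Or.inr (f.monotone hab)

theorem continuous_mapFun (f : P →o Q) : Continuous (mapFun f) := by
  classical
  rw [continuous_dom_iff]
  intro c
  let g : c.finset → (c.map f).finset := fun a =>
    ⟨f a, (NonemptyFiniteChains.mem_map_iff c f _).2 ⟨a, a.2, rfl⟩⟩
  have h : mapFun f ∘ simplex c = simplex (c.map f) ∘ stdSimplex.map g := by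
    funext v
    apply OrderComplex.ext
    simp only [Function.comp_apply, mapFun, simplex, Finsupp.embDomain_eq_mapDomain]
    have hg : (Finsupp.equivFunOnFinite.symm (stdSimplex.map g v).1 :
        (c.map f).finset →₀ ℝ) = (Finsupp.equivFunOnFinite.symm v.1).mapDomain g := by
      ext b
      simp only [stdSimplex.map, FunOnFinite.linearMap]
      rfl
    rw [hg, ← Finsupp.mapDomain_comp, ← Finsupp.mapDomain_comp]
    rfl
  rw [h]
  exact (continuous_simplex _).comp (stdSimplex.continuous_map g)

/-- The continuous map of realizations induced by an order-preserving map. -/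
def map (f : P →o Q) : C(OrderComplex P, OrderComplex Q) :=
  ⟨mapFun f, continuous_mapFun f⟩

end OrderComplex

/-! ### Group actions on chains -/

/-- An order-preserving action on a poset acts elementwise on its nonempty finite chains. -/
instance chainAction {M X : Type*} [Monoid M] [PartialOrder X] [MulAction M X]
    [CovariantClass M X (· • ·) (· ≤ ·)] : MulAction M (NonemptyFiniteChains X) where
  smul g c := c.map ⟨fun x => g • x, fun _ _ h => CovariantClass.elim g h⟩
  one_smul c := by
    ext x
    exact (NonemptyFiniteChains.mem_map_iff _ _ _).trans (by simp)
  mul_smul g h c := by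
    ext x
    refine (NonemptyFiniteChains.mem_map_iff _ _ _).trans
      (Iff.trans ?_ (NonemptyFiniteChains.mem_map_iff _ _ _).symm)
    constructor
    · rintro ⟨y, hy, rfl⟩
      exact ⟨h • y, (NonemptyFiniteChains.mem_map_iff _ _ _).2 ⟨y, hy, rfl⟩,
        (mul_smul g h y).symm⟩
    · rintro ⟨z, hz, rfl⟩
      obtain ⟨y, hy, rfl⟩ := (NonemptyFiniteChains.mem_map_iff _ _ _).1 hz
      exact ⟨y, hy, mul_smul g h y⟩

/-! ### Free factors and decompositions -/

section Group

variable {G : Type*} [Group G]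

/-- `A` is a free factor of `G`: there is `K ≤ G` such that the natural map `A * K → G` is an
isomorphism. -/
def IsFreeFactor (A : Subgroup G) : Prop :=
  ∃ K : Subgroup G, Function.Bijective (Monoid.Coprod.lift A.subtype K.subtype)

/-- `A` is a non-trivial proper free factor of `G`. -/
def IsProperFreeFactor (A : Subgroup G) : Prop :=
  IsFreeFactor A ∧ A ≠ ⊥ ∧ A ≠ ⊤

/-- The natural map from the free product of the members of `d` to `G`. -/
def freeProductMap (d : Set (Subgroup G)) : Monoid.CoprodI (fun A : d => A.1) →* G :=
  Monoid.CoprodI.lift fun A : d => A.1.subtype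

/-- `d` is a partial decomposition of `G`: a non-empty finite set of non-trivial proper free
factors such that the natural map from their free product to `G` is injective and its image is a
free factor. -/
def IsPartialDecomposition (d : Set (Subgroup G)) : Prop :=
  d.Nonempty ∧ d.Finite ∧ (∀ A ∈ d, IsProperFreeFactor A) ∧
    Function.Injective (freeProductMap d) ∧ IsFreeFactor (freeProductMap d).range

/-- `d` is a full decomposition of `G`: a partial decomposition whose members generate `G`. -/
def IsFullDecomposition (d : Set (Subgroup G)) : Prop :=
  IsPartialDecomposition d ∧ sSup d = ⊤

/-- The refinement relation. -/
def Refines (c d : Set (Subgroup G)) : Prop :=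
  ∀ A ∈ c, ∃ B ∈ d, A ≤ B

theorem Refines.refl (c : Set (Subgroup G)) : Refines c c :=
  fun A hA => ⟨A, hA, le_rfl⟩

theorem Refines.trans {c d e : Set (Subgroup G)} (h : Refines c d) (h₂ : Refines d e) :
    Refines c e := by
  intro A hA
  obtain ⟨B, hB, hAB⟩ := h A hA
  obtain ⟨C, hC, hBC⟩ := h₂ B hB
  exact ⟨C, hC, hAB.trans hBC⟩

theorem Refines.smul {c d : Set (Subgroup G)} (h : Refines c d) (g : MulAut G) :
    Refines (g • c) (g • d) := by
  rintro _ ⟨A, hA, rfl⟩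
  obtain ⟨B, hB, hAB⟩ := h A hA
  exact ⟨g • B, Set.smul_mem_smul_set hB, Subgroup.pointwise_smul_le_pointwise_smul_iff.2 hAB⟩

theorem IsPartialDecomposition.eq_of_le {d : Set (Subgroup G)} (hd : IsPartialDecomposition d)
    {A B : Subgroup G} (hA : A ∈ d) (hB : B ∈ d) (hAB : A ≤ B) : A = B := by
  classical
  by_contra hne
  apply (hd.2.2.1 A hA).2.1
  rw [eq_bot_iff]
  intro x hx
  have h1 : freeProductMap d (Monoid.CoprodI.of (i := (⟨A, hA⟩ : d)) ⟨x, hx⟩) =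
      freeProductMap d (Monoid.CoprodI.of (i := (⟨B, hB⟩ : d)) ⟨x, hAB hx⟩) := by
    simp [freeProductMap]
  have h2 := hd.2.2.2.1 h1
  have h3 := congrArg (Monoid.CoprodI.lift (Pi.mulSingle (⟨A, hA⟩ : d) (MonoidHom.id _))) h2
  have hne2 : (⟨B, hB⟩ : d) ≠ ⟨A, hA⟩ := fun h => hne (congrArg Subtype.val h).symm
  rw [Monoid.CoprodI.of_leftInverse, Monoid.CoprodI.lift_of, Pi.mulSingle_eq_of_ne hne2] at h3
  simpa using congrArg Subtype.val h3

theorem IsPartialDecomposition.subset_of_refines {c d : Set (Subgroup G)}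
    (hc : IsPartialDecomposition c) (h : Refines c d) (h₂ : Refines d c) : c ⊆ d := by
  intro A hA
  obtain ⟨B, hB, hAB⟩ := h A hA
  obtain ⟨C, hC, hBC⟩ := h₂ B hB
  have hAC := hc.eq_of_le hA hC (hAB.trans hBC)
  have : A = B := le_antisymm hAB (hAC ▸ hBC)
  exact this ▸ hB

theorem IsFreeFactor.smul {A : Subgroup G} (h : IsFreeFactor A) (g : MulAut G) :
    IsFreeFactor (g • A) := by
  obtain ⟨K, hK⟩ := h
  refine ⟨g • K, ?_⟩
  let e := MulEquiv.coprodCongr (Subgroup.equivSMul g A) (Subgroup.equivSMul g K)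
  have hcomp : ((Monoid.Coprod.lift (g • A).subtype (g • K).subtype).comp e.toMonoidHom) =
      (MulEquiv.toMonoidHom g).comp (Monoid.Coprod.lift A.subtype K.subtype) := by
    apply Monoid.Coprod.hom_ext <;> ext x <;> rfl
  have hb : Function.Bijective
      (⇑(Monoid.Coprod.lift (g • A).subtype (g • K).subtype) ∘ ⇑e) := by
    have h2 : ⇑(Monoid.Coprod.lift (g • A).subtype (g • K).subtype) ∘ ⇑e =
        ⇑g ∘ ⇑(Monoid.Coprod.lift A.subtype K.subtype) :=
      congrArg DFunLike.coe hcomp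
    rw [h2]
    exact (MulEquiv.bijective g).comp hK
  exact (Function.Bijective.of_comp_iff _ e.bijective).1 hb

theorem smul_top_subgroup (g : MulAut G) : g • (⊤ : Subgroup G) = ⊤ := by
  ext x
  simp [Subgroup.mem_pointwise_smul_iff_inv_smul_mem]

theorem IsProperFreeFactor.smul {A : Subgroup G} (h : IsProperFreeFactor A) (g : MulAut G) :
    IsProperFreeFactor (g • A) := by
  refine ⟨h.1.smul g, fun h0 => h.2.1 ?_, fun h0 => h.2.2 ?_⟩
  · rw [← Subgroup.smul_bot g] at h0
    exact MulAction.injective g h0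
  · rw [← smul_top_subgroup g] at h0
    exact MulAction.injective g h0

theorem freeProductMap_range (d : Set (Subgroup G)) : (freeProductMap d).range = sSup d := by
  rw [freeProductMap, Monoid.CoprodI.range_eq_iSup, sSup_eq_iSup']
  simp

theorem sSup_smul_subgroup (d : Set (Subgroup G)) (g : MulAut G) :
    sSup (g • d) = g • sSup d := by
  apply le_antisymm
  · refine sSup_le ?_
    rintro _ ⟨A, hA, rfl⟩
    exact Subgroup.pointwise_smul_le_pointwise_smul_iff.2 (le_sSup hA)
  · rw [Subgroup.pointwise_smul_subset_iff]
    refine sSup_le fun A hA => ?_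
    rw [← Subgroup.pointwise_smul_subset_iff]
    exact le_sSup (Set.smul_mem_smul_set hA)

theorem freeProductMap_injective_smul {d : Set (Subgroup G)} (g : MulAut G)
    (h : Function.Injective (freeProductMap d)) :
    Function.Injective (freeProductMap (g • d)) := by
  have key : ∀ (A B : (g • d : Set (Subgroup G))) (a : A.1) (b : B.1), A = B → a.1 = b.1 →
      Monoid.CoprodI.of (M := fun A : (g • d : Set (Subgroup G)) => A.1) (i := A) a =
        Monoid.CoprodI.of (M := fun A : (g • d : Set (Subgroup G)) => A.1) (i := B) b := by
    intro A B a b hAB hab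
    subst hAB
    exact congrArg _ (Subtype.ext hab)
  let f : Monoid.CoprodI (fun A : (g • d : Set (Subgroup G)) => A.1) →*
      Monoid.CoprodI (fun A : d => A.1) :=
    Monoid.CoprodI.lift fun A =>
      (Monoid.CoprodI.of (M := fun A : d => A.1)
        (i := ⟨g⁻¹ • A.1, Set.mem_smul_set_iff_inv_smul_mem.1 A.2⟩)).comp
        (Subgroup.equivSMul g⁻¹ A.1).toMonoidHom
  let k : Monoid.CoprodI (fun A : d => A.1) →*
      Monoid.CoprodI (fun A : (g • d : Set (Subgroup G)) => A.1) :=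
    Monoid.CoprodI.lift fun A =>
      (Monoid.CoprodI.of (M := fun A : (g • d : Set (Subgroup G)) => A.1)
        (i := ⟨g • A.1, Set.smul_mem_smul_set A.2⟩)).comp
        (Subgroup.equivSMul g A.1).toMonoidHom
  have hkf : k.comp f = MonoidHom.id _ := by
    apply Monoid.CoprodI.ext_hom
    intro A
    ext a
    simp only [f, k, MonoidHom.comp_apply, Monoid.CoprodI.lift_of, MonoidHom.id_apply]
    apply key
    · exact Subtype.ext (smul_inv_smul g A.1)
    · exact smul_inv_smul g a.1
  have hf : Function.Injective f :=
    Function.LeftInverse.injective (g := k) fun x => DFunLike.congr_fun hkf x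
  have hcomp : (MulEquiv.toMonoidHom g).comp ((freeProductMap d).comp f) =
      freeProductMap (g • d) := by
    apply Monoid.CoprodI.ext_hom
    intro A
    ext a
    simp only [f, freeProductMap, MonoidHom.comp_apply, Monoid.CoprodI.lift_of]
    exact smul_inv_smul g a.1
  rw [← hcomp]
  exact (MulEquiv.injective g).comp (h.comp hf)

theorem IsPartialDecomposition.smul {d : Set (Subgroup G)} (h : IsPartialDecomposition d)
    (g : MulAut G) : IsPartialDecomposition (g • d) := by
  obtain ⟨h1, h2, h3, h4, h5⟩ := h
  refine ⟨h1.smul_set, h2.smul_set, ?_, freeProductMap_injective_smul g h4, ?_⟩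
  · rintro _ ⟨A, hA, rfl⟩
    exact (h3 A hA).smul g
  · rw [freeProductMap_range, sSup_smul_subgroup, ← freeProductMap_range]
    exact h5.smul g

theorem IsFullDecomposition.smul {d : Set (Subgroup G)} (h : IsFullDecomposition d)
    (g : MulAut G) : IsFullDecomposition (g • d) :=
  ⟨h.1.smul g, by rw [sSup_smul_subgroup, h.2, smul_top_subgroup]⟩

end Group

/-! ### The posets `PD(F_n)` and `FCD_n` -/

/-- The free group of rank `n`. -/
abbrev FreeGroupOfRank (n : ℕ) : Type := FreeGroup (Fin n)

/-- `d` is a non-empty set of non-trivial proper free factors of `F_n` that is basis compatible: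
some basis of `F_n` has, for every `A ∈ d`, a subset generating `A`. -/
def IsBasisCompatible {n : ℕ} (d : Set (Subgroup (FreeGroupOfRank n))) : Prop :=
  d.Nonempty ∧ (∀ A ∈ d, IsProperFreeFactor A) ∧
    ∃ b : FreeGroupBasis (Fin n) (FreeGroupOfRank n),
      ∀ A ∈ d, ∃ S : Set (Fin n), A = Subgroup.closure (b '' S)

theorem IsBasisCompatible.smul {n : ℕ} {d : Set (Subgroup (FreeGroupOfRank n))}
    (h : IsBasisCompatible d) (g : MulAut (FreeGroupOfRank n)) : IsBasisCompatible (g • d) := by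
  obtain ⟨h1, h2, b, hb⟩ := h
  refine ⟨h1.smul_set, ?_, b.map g, ?_⟩
  · rintro _ ⟨A, hA, rfl⟩
    exact (h2 A hA).smul g
  · rintro _ ⟨A, hA, rfl⟩
    obtain ⟨S, rfl⟩ := hb A hA
    refine ⟨S, ?_⟩
    simp only [Subgroup.smul_closure]
    congr 1
    ext x
    simp [Set.mem_smul_set]

/-- `PD(F_n)`: the partial decompositions of `F_n`, ordered by refinement. -/
@[ext]
structure PD (n : ℕ) where
  factors : Set (Subgroup (FreeGroupOfRank n))
  isPartialDecomposition : IsPartialDecomposition factors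

instance (n : ℕ) : PartialOrder (PD n) where
  le c d := Refines c.factors d.factors
  le_refl c := Refines.refl _
  le_trans _ _ _ h h₂ := h.trans h₂
  le_antisymm c d h h₂ := PD.ext <| Set.Subset.antisymm
    (c.isPartialDecomposition.subset_of_refines h h₂)
    (d.isPartialDecomposition.subset_of_refines h₂ h)

/-- An automorphism `g` sends `{A₁, …, Aₖ}` to `{g(A₁), …, g(Aₖ)}`. -/
instance (n : ℕ) : MulAction (MulAut (FreeGroupOfRank n)) (PD n) where
  smul g d := ⟨g • d.factors, d.isPartialDecomposition.smul g⟩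
  one_smul d := PD.ext (one_smul _ d.factors)
  mul_smul g h d := PD.ext (mul_smul g h d.factors)

instance (n : ℕ) : CovariantClass (MulAut (FreeGroupOfRank n)) (PD n) (· • ·) (· ≤ ·) where
  elim g _ _ h := Refines.smul h g

/-- `FCD_n`: the pairs `(A, d)` where either `A` is a non-trivial proper free factor and `d` is a
full decomposition such that `{A} ∪ d` is basis compatible, or `A` is a non-trivial proper free
factor and `d = ∅`, or `A = F_n` and `d` is a full decomposition. -/
@[ext]
structure FCD (n : ℕ) where
  factor : Subgroup (FreeGroupOfRank n)
  decomposition : Set (Subgroup (FreeGroupOfRank n))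
  compatible :
    (IsProperFreeFactor factor ∧ IsFullDecomposition decomposition ∧
      IsBasisCompatible ({factor} ∪ decomposition)) ∨
    (IsProperFreeFactor factor ∧ decomposition = ∅) ∨
    (factor = ⊤ ∧ IsFullDecomposition decomposition)

theorem FCD.subset_of_refines {n : ℕ} (x : FCD n) {d : Set (Subgroup (FreeGroupOfRank n))}
    (h : Refines x.decomposition d) (h₂ : Refines d x.decomposition) : x.decomposition ⊆ d := by
  rcases x.compatible with hx | hx | hx
  · exact hx.2.1.1.subset_of_refines h h₂
  · rw [hx.2]
    exact Set.empty_subset _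
  · exact hx.2.1.subset_of_refines h h₂

/-- `(A, d) ≤ (B, e)` if and only if `A ⊇ B` and `d` refines `e`; the empty set refines every
decomposition and is refined only by itself. -/
instance (n : ℕ) : PartialOrder (FCD n) where
  le x y := y.factor ≤ x.factor ∧ Refines x.decomposition y.decomposition
  le_refl x := ⟨le_rfl, Refines.refl _⟩
  le_trans _ _ _ h h₂ := ⟨h₂.1.trans h.1, h.2.trans h₂.2⟩
  le_antisymm x y h h₂ := FCD.ext (le_antisymm h₂.1 h.1) <| Set.Subset.antisymm
    (x.subset_of_refines h.2 h₂.2) (y.subset_of_refines h₂.2 h.2)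

/-- An automorphism `g` sends `(A, d)` to `(g(A), g(d))`. -/
instance (n : ℕ) : MulAction (MulAut (FreeGroupOfRank n)) (FCD n) where
  smul g x :=
    { factor := g • x.factor
      decomposition := g • x.decomposition
      compatible := by
        rcases x.compatible with h | h | h
        · refine Or.inl ⟨h.1.smul g, h.2.1.smul g, ?_⟩
          rw [← Set.smul_set_singleton, ← Set.smul_set_union]
          exact h.2.2.smul g
        · exact Or.inr (Or.inl ⟨h.1.smul g, by rw [h.2, Set.smul_set_empty]⟩)
        · exact Or.inr (Or.inr ⟨by rw [h.1, smul_top_subgroup], h.2.smul g⟩) }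
  one_smul x := FCD.ext (one_smul _ x.factor) (one_smul _ x.decomposition)
  mul_smul g h x := FCD.ext (mul_smul g h x.factor) (mul_smul g h x.decomposition)

end

/-! The map φ sends a chain to the join of its smallest member, paired with its largest member if
that is full and with ∅ otherwise. By Quillen's fibre lemma it is enough that {s | φ s ≤ x} is
contractible for every x = (A, e). A chain lies in this set exactly when all its members lie in
`fibre x` (`toFCD_le_iff`), so the set is the poset of chains of `fibre x`, and
`contractibleSpace_chainsIn` reduces the question to `fibre x` itself. That poset is conically
contractible: d ≤ gather d ≥ c. Here gather d keeps the join B of d; it consists of the non-trivial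
B ∩ E with E ∈ e if d refines e, and is {B} otherwise. The lower bound c consists of the non-trivial
A ∩ E, or is {A} if e = ∅.

The algebra behind this is that the sets B ∩ E form a partial decomposition with join B, which
follows from a basis adapted to both d and e (`IsFullDecomposition.exists_spans`). Starting from a
basis adapted to d, those of its elements that lie in E extend to a basis of E
(`exists_basis_subgroup`, a Nielsen–Schreier argument with control of the basis). Since the group is
the free product of the E, these bases together form a basis of it; it contains generators of every
member of d because each such member lies in some E.

The topology rests on carriers (`exists_isCarried`): if C p is contractible and monotone in p, then
maps sending the simplices with vertices below p into C p exist and are all homotopic. They are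
built by recursion on the greatest vertex, each simplex being a cone over a smaller one. This yields
Quillen's lemma, the homotopy inverse being carried by the fibres. -/

noncomputable section

/-! ### Extending basis elements to a basis of a subgroup -/

namespace FreeGroupBasis

variable {ι G : Type} [Group G]

theorem closure_range (b : FreeGroupBasis ι G) : Subgroup.closure (Set.range b) = ⊤ := by
  have h : (Subgroup.closure (Set.range b)).subtype.comp
      (b.lift fun i => ⟨b i, Subgroup.subset_closure ⟨i, rfl⟩⟩) = MonoidHom.id G :=
    b.ext_hom _ _ fun i => by simp
  rw [eq_top_iff]
  intro x _
  have := DFunLike.congr_fun h x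
  rw [MonoidHom.comp_apply, MonoidHom.id_apply] at this
  rw [← this]
  exact SetLike.coe_mem _

theorem lift_coe {H : Type*} [Group H] (b : FreeGroupBasis ι G) (f : ι → H) (i : ι) :
    b.lift f (b i) = f i := by
  simp

end FreeGroupBasis

/-! ### Spanning trees of Schreier graphs. -/

section SchreierTree

variable {ι G X : Type} [Group G] [MulAction G X]

/-- The points of `X` that can be reached from `o` in at most `n` steps. -/
def schreierBall (s : ι → G) (o : X) : ℕ → Set X
  | 0 => {o}
  | n + 1 => schreierBall s o n ∪
      {x | ∃ y ∈ schreierBall s o n, ∃ i, s i • y = x ∨ s i • x = y}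

/-- Being reachable is invariant under each generator in both directions, hence under the whole
group, which acts transitively. -/
theorem exists_mem_schreierBall {s : ι → G} (hs : Subgroup.closure (Set.range s) = ⊤)
    [MulAction.IsPretransitive G X] (o x : X) : ∃ n, x ∈ schreierBall s o n := by
  obtain ⟨g, rfl⟩ := MulAction.exists_smul_eq G o x
  have key : ∀ g ∈ Subgroup.closure (Set.range s), ∀ x : X,
      (∃ n, x ∈ schreierBall s o n) ↔ ∃ n, g • x ∈ schreierBall s o n := by
    intro g hg
    induction hg using Subgroup.closure_induction with
    | mem g hg =>
      obtain ⟨i, rfl⟩ := hg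
      intro x
      constructor
      · rintro ⟨n, hn⟩
        exact ⟨n + 1, Or.inr ⟨x, hn, i, Or.inl rfl⟩⟩
      · rintro ⟨n, hn⟩
        exact ⟨n + 1, Or.inr ⟨_, hn, i, Or.inr rfl⟩⟩
    | one => simp
    | mul g h _ _ hg hh =>
      intro x
      rw [hh x, hg, mul_smul]
    | inv g _ hg =>
      intro x
      rw [hg (g⁻¹ • x), smul_inv_smul]
  exact (key g (hs ▸ Subgroup.mem_top g) o).1 ⟨0, rfl⟩

/-- A transitive action of a group with generators `s i` has a spanning tree `T` of its Schreier
graph without loops, together with a transversal that is multiplicative along `T`. -/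
theorem exists_schreierTree {s : ι → G} (hs : Subgroup.closure (Set.range s) = ⊤)
    [MulAction.IsPretransitive G X] (o : X) :
    ∃ (t : X → G) (T : Set (X × ι)), t o = 1 ∧ (∀ x, t x • o = x) ∧
      (∀ x i, (x, i) ∈ T → t (s i • x) = s i * t x) ∧
      (∀ x i, (x, i) ∈ T → s i • x ≠ x) ∧
      ∀ P : X → Prop, P o → (∀ x i, (x, i) ∈ T → (P x ↔ P (s i • x))) → ∀ x, P x := by
  classical
  -- The distance from `o`; every other point has a neighbour that is strictly closer, which will be
  -- its parent in the tree.
  let l : X → ℕ := fun x => Nat.find (exists_mem_schreierBall hs o x)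
  have hl : ∀ x, x ≠ o → ∃ y, l y < l x ∧ ∃ i, s i • y = x ∨ s i • x = y := by
    intro x hx
    have h1 : x ∈ schreierBall s o (l x) := Nat.find_spec (exists_mem_schreierBall hs o x)
    have h2 : ∀ m < l x, x ∉ schreierBall s o m := fun m hm =>
      Nat.find_min (exists_mem_schreierBall hs o x) hm
    generalize l x = n at h1 h2
    cases n with
    | zero => exact (hx h1).elim
    | succ n =>
      rcases h1 with h1 | ⟨y, hy, hi⟩
      · exact (h2 n n.lt_succ_self h1).elim
      · exact ⟨y, Nat.lt_succ_of_le (Nat.find_min' _ hy), hi⟩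
  -- Without generators `X` is a single point; this case is separate because choosing labels for all
  -- points, `o` included, needs a default label.
  rcases isEmpty_or_nonempty ι with hι | hι
  · have hx : ∀ x, x = o := fun x => by
      by_contra h
      obtain ⟨_, _, i, _⟩ := hl x h
      exact hι.elim i
    exact ⟨fun _ => 1, ∅, rfl, fun x => by rw [one_smul, hx x], by simp, by simp,
      fun P h0 _ x => hx x ▸ h0⟩
  choose! p hp i hi using hl
  let t : X → G := (measure l).wf.fix fun x rec =>
    if h : x = o then 1
    else (if s (i x) • p x = x then s (i x) else (s (i x))⁻¹) * rec (p x) (hp x h)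
  have ht : ∀ x, t x = if x = o then 1
      else (if s (i x) • p x = x then s (i x) else (s (i x))⁻¹) * t (p x) := by
    intro x
    have := (measure l).wf.fix_eq (fun x rec => if h : x = o then (1 : G)
      else (if s (i x) • p x = x then s (i x) else (s (i x))⁻¹) * rec (p x) (hp x h)) x
    simpa only [dite_eq_ite] using this
  -- Each `x ≠ o` contributes the edge joining it to its parent, recorded at whichever end is its
  -- source. The ends differ in distance from `o`, so the edge is not a loop.
  refine ⟨t, {e | ∃ x, x ≠ o ∧ e.2 = i x ∧ ((s (i x) • p x = x ∧ e.1 = p x) ∨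
    (s (i x) • p x ≠ x ∧ e.1 = x))}, by simp [ht o], ?_, ?_, ?_, ?_⟩
  · intro x
    induction hn : l x using Nat.strong_induction_on generalizing x with
    | _ n ih =>
      rw [ht]
      by_cases hx : x = o
      · simp [hx]
      · rw [if_neg hx, mul_smul, ih _ (hn ▸ hp x hx) (p x) rfl]
        split_ifs with h
        · exact h
        · rw [inv_smul_eq_iff, (hi x hx).resolve_left h]
  · rintro y j ⟨x, hx, rfl, (⟨h, rfl⟩ | ⟨h, h3⟩)⟩
    · rw [h, ht x, if_neg hx, if_pos h]
    · obtain rfl : y = x := h3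
      rw [ht y, if_neg hx, if_neg h, (hi y hx).resolve_left h, mul_inv_cancel_left]
  · rintro y j ⟨x, hx, rfl, (⟨h, rfl⟩ | ⟨h, h3⟩)⟩
    · rw [h]
      intro h2
      have := hp x hx
      rw [← h2] at this
      exact lt_irrefl _ this
    · obtain rfl : y = x := h3
      rw [(hi y hx).resolve_left h]
      intro h2
      have := hp y hx
      rw [h2] at this
      exact lt_irrefl _ this
  · intro P h0 hP x
    induction hn : l x using Nat.strong_induction_on generalizing x with
    | _ n ih =>
      by_cases hx : x = o
      · rwa [hx]
      · have h1 := ih _ (hn ▸ hp x hx) (p x) rfl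
        by_cases h : s (i x) • p x = x
        · rw [← h]
          exact (hP (p x) (i x) ⟨x, hx, rfl, Or.inl ⟨h, rfl⟩⟩).1 h1
        · refine (hP x (i x) ⟨x, hx, rfl, Or.inr ⟨h, rfl⟩⟩).2 ?_
          rwa [(hi x hx).resolve_left h]

end SchreierTree

/-! ### Schreier bases of subgroups of free groups. -/

namespace FreeGroupBasis

variable {ι G : Type} [Group G]

/-- A labelling of the edges of the Schreier graph of an action of a free group on `X` by elements
of `H` defines an action on `X × H`. -/
def labelAction {X H : Type} [Group H] [MulAction G X] (b : FreeGroupBasis ι G)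
    (f : X × ι → H) : G →* Equiv.Perm (X × H) :=
  b.lift fun i =>
    { toFun := fun x => (b i • x.1, f (x.1, i) * x.2)
      invFun := fun x => ((b i)⁻¹ • x.1, (f ((b i)⁻¹ • x.1, i))⁻¹ * x.2)
      left_inv := fun x => by simp
      right_inv := fun x => by simp }

theorem labelAction_basis {X H : Type} [Group H] [MulAction G X] (b : FreeGroupBasis ι G)
    (f : X × ι → H) (i : ι) (x : X × H) :
    b.labelAction f (b i) x = (b i • x.1, f (x.1, i) * x.2) := by
  rw [labelAction, lift_coe]
  rfl

/-- Labels act by left multiplication, so the action commutes with right translation of `H` and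
covers the action on `X`. -/
theorem labelAction_mul_right {X H : Type} [Group H] [MulAction G X] (b : FreeGroupBasis ι G)
    (f : X × ι → H) (g : G) (x : X) (h k : H) :
    b.labelAction f g (x, h * k) =
      (g • x, (b.labelAction f g (x, h)).2 * k) ∧ (b.labelAction f g (x, h)).1 = g • x := by
  have key : ∀ g ∈ Subgroup.closure (Set.range b), ∀ (x : X) (h k : H),
      b.labelAction f g (x, h * k) =
      (g • x, (b.labelAction f g (x, h)).2 * k) ∧ (b.labelAction f g (x, h)).1 = g • x := by
    intro g hg
    induction hg using Subgroup.closure_induction with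
    | mem g hg =>
      obtain ⟨i, rfl⟩ := hg
      intro x h k
      simp [labelAction_basis, mul_assoc]
    | one => simp
    | mul g g' _ _ hg hg' =>
      intro x h k
      have e : b.labelAction f g' (x, h) = (g' • x, (b.labelAction f g' (x, h)).2) :=
        Prod.ext (hg' x h 1).2 rfl
      rw [map_mul, Equiv.Perm.mul_apply, (hg' x h k).1, (hg _ _ _).1, Equiv.Perm.mul_apply, e,
        mul_smul]
      exact ⟨rfl, (hg _ _ 1).2⟩
    | inv g _ hg =>
      intro x h k
      have e : (b.labelAction f g⁻¹ (x, h)).1 = g⁻¹ • x := by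
        have h1 := (hg (b.labelAction f g⁻¹ (x, h)).1 (b.labelAction f g⁻¹ (x, h)).2 1).2
        rw [Prod.mk.eta, map_inv, Equiv.Perm.inv_def, Equiv.apply_symm_apply, ← Equiv.Perm.inv_def,
          ← map_inv] at h1
        rw [eq_inv_smul_iff, ← h1]
      refine ⟨?_, e⟩
      rw [map_inv, Equiv.Perm.inv_eq_iff_eq, ← map_inv, (hg _ _ _).1, smul_inv_smul]
      have h1 : (g⁻¹ • x, (b.labelAction f g⁻¹ (x, h)).2) = b.labelAction f g⁻¹ (x, h) :=
        Prod.ext e.symm rfl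
      rw [h1, map_inv, Equiv.Perm.inv_def, Equiv.apply_symm_apply]
  exact key g (b.closure_range ▸ Subgroup.mem_top g) x h k

theorem ofUniqueLift_coe {X : Type} (of : X → G)
    (h : ∀ {H : Type} [Group H] (f : X → H), ∃! F : G →* H, ∀ a, F (of a) = f a) (x : X) :
    ofUniqueLift X of h x = of x := by
  change (ofUniqueLift X of h).repr.symm (FreeGroup.of _) = _
  simp [ofUniqueLift, ofLift]

/-- The elements of a basis of a free group that lie in a subgroup extend to a basis of the
subgroup. -/
theorem exists_basis_subgroup (b : FreeGroupBasis ι G) (E : Subgroup G) :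
    ∃ (κ : Type) (c : FreeGroupBasis κ E), ∀ i, b i ∈ E → ∃ k, (c k : G) = b i := by
  classical
  let o : G ⧸ E := ((1 : G) : G ⧸ E)
  obtain ⟨t, T, t1, t2, t3, t4, t5⟩ := exists_schreierTree b.closure_range o
  have ho : ∀ g : G, g • o = o ↔ g ∈ E := by
    intro g
    have : g • o = ((g * 1 : G) : G ⧸ E) := rfl
    rw [this, mul_one]
    simp only [o]
    rw [eq_comm, QuotientGroup.eq]
    simp
  have hmem : ∀ g x, (t (g • x))⁻¹ * (g * t x) ∈ E := by
    intro g x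
    rw [← ho, mul_smul, mul_smul, t2, inv_smul_eq_iff, t2]
  -- The Schreier generators, one for each edge outside the tree. Their universal property is
  -- checked directly.
  let y : (Tᶜ : Set ((G ⧸ E) × ι)) → E := fun e =>
    ⟨(t (b e.1.2 • e.1.1))⁻¹ * (b e.1.2 * t e.1.1), hmem _ _⟩
  have huniv : ∀ {H : Type} [Group H] (f : (Tᶜ : Set ((G ⧸ E) × ι)) → H),
      ∃! F : E →* H, ∀ a, F (y a) = f a := by
    intro H _ f
    -- With trivial labels along the tree, `t x` carries `(o, 1)` to `(x, 1)`. The extension of `f`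
    -- sends `e ∈ E` to the label collected when `e` acts on `(o, 1)`.
    let f' : (G ⧸ E) × ι → H := fun e => if h : e ∈ T then 1 else f ⟨e, h⟩
    have hA : ∀ x, b.labelAction f' (t x) (o, 1) = (x, 1) := by
      refine t5 _ (by rw [t1, map_one, Equiv.Perm.one_apply]) ?_
      intro x i hx
      have h1 : f' (x, i) = 1 := dif_pos hx
      rw [t3 x i hx, map_mul, Equiv.Perm.mul_apply]
      have h2 : b.labelAction f' (b i) (x, 1) = (b i • x, 1) := by
        rw [labelAction_basis, h1, mul_one]
      rw [← h2, (b.labelAction f' (b i)).injective.eq_iff]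
    have hA2 : ∀ x h, b.labelAction f' (t x) (o, h) = (x, h) := by
      intro x h
      have := (b.labelAction_mul_right f' (t x) o 1 h).1
      rwa [one_mul, hA, t2, one_mul] at this
    let F : E →* H := MonoidHom.mk' (fun e => (b.labelAction f' e.1 (o, 1)).2) (by
      intro e e'
      have h1 : b.labelAction f' e'.1 (o, 1) = (o, (b.labelAction f' e'.1 (o, 1)).2) :=
        Prod.ext ((b.labelAction_mul_right f' e'.1 o 1 1).2.trans ((ho _).2 e'.2)) rfl
      have h2 := (b.labelAction_mul_right f' e.1 o 1 (b.labelAction f' e'.1 (o, 1)).2).1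
      rw [one_mul] at h2
      simp only [Subgroup.coe_mul]
      rw [map_mul, Equiv.Perm.mul_apply, h1, h2])
    have hF : ∀ a, F (y a) = f a := by
      rintro ⟨⟨x, i⟩, hx⟩
      have h1 : f' (x, i) = f ⟨(x, i), hx⟩ := dif_neg hx
      change (b.labelAction f' ((t (b i • x))⁻¹ * (b i * t x)) (o, 1)).2 = _
      have : b.labelAction f' ((t (b i • x))⁻¹ * (b i * t x)) (o, 1) = (o, f' (x, i)) := by
        rw [map_mul, map_mul, map_inv, Equiv.Perm.mul_apply, Equiv.Perm.inv_eq_iff_eq,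
          Equiv.Perm.mul_apply, hA, hA2, labelAction_basis, mul_one]
      rw [this, h1]
    refine ⟨F, hF, ?_⟩
    intro F' hF'
    -- Uniqueness: the elements `(t (g • x))⁻¹ * (g * t x)` are multiplicative along products of
    -- generators, so they are determined by the `y`; at `x = o` they exhaust `E`.
    have key : ∀ g ∈ Subgroup.closure (Set.range b), ∀ x,
        F' ⟨_, hmem g x⟩ = F ⟨_, hmem g x⟩ := by
      intro g hg
      induction hg using Subgroup.closure_induction with
      | mem g hg =>
        obtain ⟨i, rfl⟩ := hg
        intro x
        by_cases hx : (x, i) ∈ T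
        · have : (⟨_, hmem (b i) x⟩ : E) = 1 := Subtype.ext (by simp [t3 x i hx])
          rw [this, map_one, map_one]
        · exact (hF' ⟨(x, i), hx⟩).trans (hF ⟨(x, i), hx⟩).symm
      | one =>
        intro x
        have : (⟨_, hmem 1 x⟩ : E) = 1 := Subtype.ext (by simp)
        rw [this, map_one, map_one]
      | mul g g' _ _ hg hg' =>
        intro x
        have : (⟨_, hmem (g * g') x⟩ : E) = ⟨_, hmem g (g' • x)⟩ * ⟨_, hmem g' x⟩ :=
          Subtype.ext (by simp [mul_smul, mul_assoc])
        rw [this, map_mul, map_mul, hg, hg']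
      | inv g _ hg =>
        intro x
        have : (⟨_, hmem g⁻¹ x⟩ : E) = (⟨_, hmem g (g⁻¹ • x)⟩)⁻¹ :=
          Subtype.ext (by simp [mul_assoc])
        rw [this, map_inv, map_inv, hg]
    ext ⟨e, he⟩
    have h1 := key e (b.closure_range ▸ Subgroup.mem_top e) o
    have h2 : (⟨(t (e • o))⁻¹ * (e * t o), hmem e o⟩ : E) = ⟨e, he⟩ :=
      Subtype.ext (by simp [(ho e).2 he, t1])
    rwa [h2] at h1
  refine ⟨_, ofUniqueLift _ y huniv, fun i hi => ?_⟩
  -- A basis element in `E` is a loop at `o`, hence outside the tree, and its Schreier generator is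
  -- itself because `t o = 1`.
  have hT : (o, i) ∉ T := fun h => t4 o i h ((ho _).2 hi)
  refine ⟨⟨(o, i), hT⟩, ?_⟩
  rw [ofUniqueLift_coe]
  simp [y, (ho _).2 hi, t1]

end FreeGroupBasis

/-! ### Subgroups generated by parts of a basis -/

namespace FreeGroupBasis

variable {ι κ G : Type} [Group G]

/-- The basis of a free product of two groups given by bases of the factors. -/
def coprod {H K : Type} [Group H] [Group K] (b : FreeGroupBasis ι H) (c : FreeGroupBasis κ K) :
    FreeGroupBasis (ι ⊕ κ) (Monoid.Coprod H K) :=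
  ⟨MulEquiv.symm <| MonoidHom.toMulEquiv
    (FreeGroup.lift (Sum.elim (fun i => Monoid.Coprod.inl (b i)) fun k => Monoid.Coprod.inr (c k)))
    (Monoid.Coprod.lift (b.lift fun i => FreeGroup.of (Sum.inl i))
      (c.lift fun k => FreeGroup.of (Sum.inr k)))
    (by ext x; rcases x with i | k <;> simp)
    (by
      apply Monoid.Coprod.hom_ext
      · apply b.ext_hom; simp
      · apply c.ext_hom; simp)⟩

theorem coprod_inl {H K : Type} [Group H] [Group K] (b : FreeGroupBasis ι H)
    (c : FreeGroupBasis κ K) (i : ι) : b.coprod c (Sum.inl i) = Monoid.Coprod.inl (b i) := by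
  change (b.coprod c).repr.symm (FreeGroup.of _) = _
  simp [coprod]

theorem coprodI_coe {J : Type} {X : J → Type} {H : J → Type} [∀ j, Group (H j)]
    (B : ∀ j, FreeGroupBasis (X j) (H j)) (j : J) (x : X j) :
    Monoid.CoprodI.FreeGroupBasis.coprodI B ⟨j, x⟩ = Monoid.CoprodI.of (B j x) := by
  change (Monoid.CoprodI.FreeGroupBasis.coprodI B).repr.symm (FreeGroup.of _) = _
  simp [Monoid.CoprodI.FreeGroupBasis.coprodI]

/-- The subgroup `A` is generated by the elements of the basis `b` that it contains. -/
def Spans (b : FreeGroupBasis ι G) (A : Subgroup G) : Prop :=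
  A ≤ Subgroup.closure (b '' {i | b i ∈ A})

variable {b : FreeGroupBasis ι G} {A B : Subgroup G}

theorem Spans.eq (h : b.Spans A) : A = Subgroup.closure (b '' {i | b i ∈ A}) := by
  refine le_antisymm h ((Subgroup.closure_le _).2 ?_)
  rintro _ ⟨i, hi, rfl⟩
  exact hi

theorem spans_closure (b : FreeGroupBasis ι G) (S : Set ι) :
    b.Spans (Subgroup.closure (b '' S)) := by
  refine Subgroup.closure_mono (Set.image_mono fun i hi => ?_)
  exact Subgroup.subset_closure ⟨i, hi, rfl⟩

theorem spans_sSup {d : Set (Subgroup G)} (h : ∀ A ∈ d, b.Spans A) : b.Spans (sSup d) := by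
  refine sSup_le fun A hA => (h A hA).trans (Subgroup.closure_mono (Set.image_mono ?_))
  intro i hi
  exact le_sSup hA hi

theorem spans_top (b : FreeGroupBasis ι G) : b.Spans ⊤ := by
  simp [Spans, b.closure_range]

/-- The homomorphism to ℤ that kills the basis elements indexed by `S` and sends the others to 1
detects the remaining ones. -/
theorem mem_closure_image_iff (b : FreeGroupBasis ι G) (S : Set ι) (i : ι) :
    b i ∈ Subgroup.closure (b '' S) ↔ i ∈ S := by
  classical
  refine ⟨fun h => ?_, fun h => Subgroup.subset_closure ⟨i, h, rfl⟩⟩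
  by_contra hi
  let f : G →* Multiplicative ℤ := b.lift fun j => if j ∈ S then 1 else Multiplicative.ofAdd 1
  have hle : Subgroup.closure (b '' S) ≤ f.ker := by
    rw [Subgroup.closure_le]
    rintro _ ⟨j, hj, rfl⟩
    change f (b j) = 1
    rw [lift_coe, if_pos hj]
  have h1 : f (b i) = 1 := hle h
  rw [lift_coe, if_neg hi] at h1
  exact absurd h1 (by decide)

theorem coe_ne_one (b : FreeGroupBasis ι G) (i : ι) : b i ≠ 1 := by
  intro h
  have := (b.mem_closure_image_iff ∅ i).1 (h ▸ Subgroup.one_mem _)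
  exact this

/-- The retraction `r` that kills the basis elements outside `B` fixes `B` pointwise and maps `A`
into the span of the basis elements in both subgroups. -/
theorem Spans.inf (hA : b.Spans A) (hB : b.Spans B) : b.Spans (A ⊓ B) := by
  classical
  intro x hx
  obtain ⟨hxA, hxB⟩ := Subgroup.mem_inf.1 hx
  let r : G →* G := b.lift fun i => if b i ∈ B then b i else 1
  have h1 : ∀ x ∈ Subgroup.closure (b '' {i | b i ∈ B}), r x = x := by
    intro x hx
    have : Set.EqOn r (MonoidHom.id G) (b '' {i | b i ∈ B}) := by
      rintro _ ⟨i, hi, rfl⟩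
      change b i ∈ B at hi
      simp only [r, lift_coe, if_pos hi, MonoidHom.id_apply]
    exact MonoidHom.eqOn_closure this hx
  have h2 : Subgroup.closure (b '' {i | b i ∈ A}) ≤
      (Subgroup.closure (b '' {i | b i ∈ A ⊓ B})).comap r := by
    rw [Subgroup.closure_le]
    rintro _ ⟨i, hi, rfl⟩
    change r (b i) ∈ Subgroup.closure (b '' {i | b i ∈ A ⊓ B})
    rw [lift_coe]
    split_ifs with hiB
    · exact Subgroup.subset_closure ⟨i, ⟨hi, hiB⟩, rfl⟩
    · exact Subgroup.one_mem _
  rw [← h1 x (hB hxB)]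
  exact h2 (hA hxA)

/-- A subgroup generated by a part of a basis is a free factor. -/
theorem Spans.isFreeFactor (h : b.Spans A) : IsFreeFactor A := by
  classical
  let K := Subgroup.closure (b '' {i | b i ∉ A})
  refine ⟨K, ?_⟩
  let f : G →* Monoid.Coprod A K := b.lift fun i => if hi : b i ∈ A
    then Monoid.Coprod.inl ⟨b i, hi⟩
    else Monoid.Coprod.inr ⟨b i, Subgroup.subset_closure ⟨i, hi, rfl⟩⟩
  have h1 : (Monoid.Coprod.lift A.subtype K.subtype).comp f = MonoidHom.id G := by
    apply b.ext_hom
    intro i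
    simp only [f, MonoidHom.comp_apply, lift_coe, MonoidHom.id_apply]
    split_ifs with hi <;> simp
  have key : ∀ x (hx : x ∈ Subgroup.closure (b '' {i | b i ∈ A})), ∀ hxA : x ∈ A,
      f x = Monoid.Coprod.inl ⟨x, hxA⟩ := by
    intro x hx
    induction hx using Subgroup.closure_induction with
    | mem x hx =>
      obtain ⟨i, hi, rfl⟩ := hx
      intro hxA
      simp only [f, lift_coe, dif_pos hxA]
    | one => intro _; rw [map_one]; exact (map_one _).symm
    | mul x y hx hy ihx ihy =>
      intro _
      rw [← h.eq] at hx hy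
      rw [map_mul, ihx hx, ihy hy, ← map_mul]; rfl
    | inv x hx ih =>
      intro _
      rw [← h.eq] at hx
      rw [map_inv, ih hx, ← map_inv]; rfl
  have key2 : ∀ x (hx : x ∈ K), f x = Monoid.Coprod.inr ⟨x, hx⟩ := by
    intro x hx
    induction hx using Subgroup.closure_induction with
    | mem x hx =>
      obtain ⟨i, hi, rfl⟩ := hx
      simp only [f, lift_coe, dif_neg hi]
    | one => rw [map_one]; exact (map_one _).symm
    | mul x y hx hy ihx ihy =>
      rw [map_mul, ihx, ihy, ← map_mul]; rfl
    | inv x hx ih => rw [map_inv, ih, ← map_inv]; rfl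
  have h2 : f.comp (Monoid.Coprod.lift A.subtype K.subtype) = MonoidHom.id _ := by
    apply Monoid.Coprod.hom_ext
    · ext x
      exact key x.1 (h x.2) x.2
    · ext x
      exact key2 x.1 x.2
  exact ⟨Function.LeftInverse.injective (g := f) fun x => DFunLike.congr_fun h2 x,
    Function.RightInverse.surjective (g := f) fun x => DFunLike.congr_fun h1 x⟩

/-- A left inverse is defined on the basis: an element goes to the factor containing it, which
`hdisj` makes unique, or to 1 if there is none. -/
theorem freeProductMap_injective {d : Set (Subgroup G)} (hd : ∀ A ∈ d, b.Spans A)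
    (hdisj : ∀ A ∈ d, ∀ B ∈ d, ∀ i, b i ∈ A → b i ∈ B → A = B) :
    Function.Injective (freeProductMap d) := by
  classical
  let f : G →* Monoid.CoprodI (fun A : d => A.1) := b.lift fun i =>
    if h : ∃ A : d, b i ∈ A.1 then Monoid.CoprodI.of (i := h.choose) ⟨b i, h.choose_spec⟩ else 1
  have hf : ∀ (A : d) i (hi : b i ∈ A.1), f (b i) =
      Monoid.CoprodI.of (M := fun A : d => A.1) (i := A) ⟨b i, hi⟩ := by
    intro A i hi
    have h : ∃ A : d, b i ∈ A.1 := ⟨A, hi⟩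
    simp only [f, lift_coe, dif_pos h]
    have hA : h.choose = A :=
      Subtype.ext (hdisj _ h.choose.2 _ A.2 i h.choose_spec hi)
    have : ∀ (B : d) (hB : b i ∈ B.1), B = A →
        Monoid.CoprodI.of (M := fun A : d => A.1) (i := B) ⟨b i, hB⟩ =
          Monoid.CoprodI.of (M := fun A : d => A.1) (i := A) ⟨b i, hi⟩ := by
      rintro B hB rfl
      rfl
    exact this _ h.choose_spec hA
  have key : ∀ (A : d), ∀ x (hx : x ∈ Subgroup.closure (b '' {i | b i ∈ A.1})),
      ∀ hxA : x ∈ A.1, f x = Monoid.CoprodI.of (M := fun A : d => A.1) (i := A) ⟨x, hxA⟩ := by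
    intro A x hx
    induction hx using Subgroup.closure_induction with
    | mem x hx =>
      obtain ⟨i, hi, rfl⟩ := hx
      exact hf A i
    | one => intro _; rw [map_one]; exact (map_one _).symm
    | mul x y hx hy ihx ihy =>
      intro _
      rw [← (hd _ A.2).eq] at hx hy
      rw [map_mul, ihx hx, ihy hy, ← map_mul]; rfl
    | inv x hx ih =>
      intro _
      rw [← (hd _ A.2).eq] at hx
      rw [map_inv, ih hx, ← map_inv]; rfl
  have h2 : f.comp (freeProductMap d) = MonoidHom.id _ := by
    apply Monoid.CoprodI.ext_hom
    intro A
    ext x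
    simp only [freeProductMap, MonoidHom.comp_apply, Monoid.CoprodI.lift_of, MonoidHom.id_apply]
    exact key A x.1 (hd _ A.2 x.2) x.2
  exact Function.LeftInverse.injective (g := f) fun x => DFunLike.congr_fun h2 x

/-- A basis of a free factor extends to a basis of the group. -/
theorem exists_basis_of_isFreeFactor (b : FreeGroupBasis ι G) (hA : IsFreeFactor A)
    (a : FreeGroupBasis κ A) :
    ∃ (μ : Type) (c : FreeGroupBasis μ G), ∀ k, ∃ m, c m = a k := by
  obtain ⟨K, hK⟩ := hA
  -- Only the freeness of the complement matters here.
  obtain ⟨ν, k, -⟩ := b.exists_basis_subgroup K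
  refine ⟨κ ⊕ ν, (a.coprod k).map (MulEquiv.ofBijective _ hK), fun i => ⟨Sum.inl i, ?_⟩⟩
  rw [FreeGroupBasis.map_apply, coprod_inl, MulEquiv.ofBijective_apply,
    Monoid.Coprod.lift_apply_inl]
  rfl

/-- Bases of the members of a free product decomposition of `A` give a basis of `A`. -/
theorem exists_basis_freeProductMap_range {d : Set (Subgroup G)}
    (hd : Function.Injective (freeProductMap d)) {X : d → Type}
    (a : ∀ A : d, FreeGroupBasis (X A) A.1) :
    ∃ (κ : Type) (c : FreeGroupBasis κ (freeProductMap d).range),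
      ∀ (A : d) (x : X A), ∃ k, (c k : G) = a A x := by
  refine ⟨_, (Monoid.CoprodI.FreeGroupBasis.coprodI a).map (MonoidHom.ofInjective hd),
    fun A x => ⟨⟨A, x⟩, ?_⟩⟩
  rw [FreeGroupBasis.map_apply, coprodI_coe, MonoidHom.ofInjective_apply, freeProductMap,
    Monoid.CoprodI.lift_of]
  rfl

theorem spans_of_forall_exists {a : FreeGroupBasis κ A} (h : ∀ k, ∃ i, b i = a k) :
    b.Spans A := by
  have h1 : A = (Subgroup.closure (Set.range a)).map A.subtype := by
    rw [a.closure_range, ← MonoidHom.range_eq_map, Subgroup.range_subtype]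
  intro x hx
  rw [h1, MonoidHom.map_closure] at hx
  refine Subgroup.closure_mono ?_ hx
  rintro _ ⟨_, ⟨k, rfl⟩, rfl⟩
  obtain ⟨i, hi⟩ := h k
  refine ⟨i, ?_, hi⟩
  change b i ∈ A
  rw [hi]
  exact (a k).2

end FreeGroupBasis

/-- Bases of the factors combine to a basis of their free product, whose image is a free factor, so
it extends to the group. -/
theorem IsPartialDecomposition.exists_spans {ι G : Type} [Group G] (b : FreeGroupBasis ι G)
    {d : Set (Subgroup G)} (hd : IsPartialDecomposition d) :
    ∃ (κ : Type) (c : FreeGroupBasis κ G), ∀ A ∈ d, c.Spans A := by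
  choose X a _ using fun A : d => b.exists_basis_subgroup A.1
  obtain ⟨κ, c, hc⟩ := FreeGroupBasis.exists_basis_freeProductMap_range hd.2.2.2.1 a
  obtain ⟨μ, m, hm⟩ := b.exists_basis_of_isFreeFactor hd.2.2.2.2 c
  refine ⟨μ, m, fun A hA => FreeGroupBasis.spans_of_forall_exists (a := a ⟨A, hA⟩) fun x => ?_⟩
  obtain ⟨k, hk⟩ := hc ⟨A, hA⟩ x
  obtain ⟨i, hi⟩ := hm k
  exact ⟨i, hi.trans hk⟩

/-- A full decomposition `e` and a partial decomposition refining it have a common basis. -/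
theorem IsFullDecomposition.exists_spans {n : ℕ} {d e : Set (Subgroup (FreeGroupOfRank n))}
    (hd : IsPartialDecomposition d) (he : IsFullDecomposition e) (hde : Refines d e) :
    ∃ c : FreeGroupBasis (Fin n) (FreeGroupOfRank n),
      (∀ A ∈ d, c.Spans A) ∧ ∀ A ∈ e, c.Spans A := by
  obtain ⟨κ, b, hb⟩ := hd.exists_spans (FreeGroupBasis.ofFreeGroup (Fin n))
  -- The basis chosen for each member of `e` keeps the elements of `b` lying in it.
  choose X a ha using fun A : e => b.exists_basis_subgroup A.1
  obtain ⟨μ, c, hc⟩ := FreeGroupBasis.exists_basis_freeProductMap_range he.1.2.2.2.1 a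
  have htop : (freeProductMap e).range = ⊤ := by rw [freeProductMap_range, he.2]
  let c' := (c.map (MulEquiv.subgroupCongr htop)).map Subgroup.topEquiv
  have hc' : ∀ k, c' k = c k := fun k => rfl
  -- Isomorphic free groups have equipotent bases, so the new basis can be indexed by `Fin n`.
  let f : μ ≃ Fin n := Equiv.ofFreeGroupEquiv c'.repr.symm
  have hf : ∀ A, c'.Spans A → (c'.reindex f).Spans A := by
    intro A hA x hx
    refine Subgroup.closure_mono ?_ (hA hx)
    rintro _ ⟨i, hi, rfl⟩
    exact ⟨f i, by simpa using hi, by simp⟩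
  refine ⟨c'.reindex f, fun A hA => hf A ?_, fun A hA => hf A ?_⟩
  -- The elements of `b` generating `A` lie in `E`, hence survive in the new basis.
  · obtain ⟨E, hE, hAE⟩ := hde A hA
    intro x hx
    refine Subgroup.closure_mono ?_ (hb A hA hx)
    rintro _ ⟨i, hi, rfl⟩
    obtain ⟨k, hk⟩ := ha ⟨E, hE⟩ i (hAE hi)
    obtain ⟨m, hm⟩ := hc ⟨E, hE⟩ k
    have : c' m = b i := by rw [hc', hm, hk]
    exact ⟨m, by simpa [this] using hi, this⟩
  · refine FreeGroupBasis.spans_of_forall_exists (a := a ⟨A, hA⟩) fun x => ?_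
    obtain ⟨k, hk⟩ := hc ⟨A, hA⟩ x
    exact ⟨k, (hc' k).trans hk⟩

/-! ### Least and greatest elements of finite chains -/

namespace PartialOrder.NonemptyFiniteChains

variable {P Q : Type*} [PartialOrder P] [PartialOrder Q]

theorem exists_isLeast (c : NonemptyFiniteChains P) : ∃ p, IsLeast (c.finset : Set P) p := by
  obtain ⟨p, hp⟩ := c.finset.exists_minimal c.nonempty
  refine ⟨p, hp.1, fun q hq => ?_⟩
  rcases c.comparable ⟨p, hp.1⟩ ⟨q, hq⟩ with h | h
  · exact h
  · exact hp.2 hq h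

theorem exists_isGreatest (c : NonemptyFiniteChains P) :
    ∃ p, IsGreatest (c.finset : Set P) p := by
  obtain ⟨p, hp⟩ := c.finset.exists_maximal c.nonempty
  refine ⟨p, hp.1, fun q hq => ?_⟩
  rcases c.comparable ⟨p, hp.1⟩ ⟨q, hq⟩ with h | h
  · exact hp.2 hq h
  · exact h

/-- The least element of a chain. -/
def bot (c : NonemptyFiniteChains P) : P := c.exists_isLeast.choose

/-- The greatest element of a chain. -/
def top (c : NonemptyFiniteChains P) : P := c.exists_isGreatest.choose

theorem bot_mem (c : NonemptyFiniteChains P) : c.bot ∈ c.finset :=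
  c.exists_isLeast.choose_spec.1

theorem bot_le (c : NonemptyFiniteChains P) {p : P} (hp : p ∈ c.finset) : c.bot ≤ p :=
  c.exists_isLeast.choose_spec.2 hp

theorem top_mem (c : NonemptyFiniteChains P) : c.top ∈ c.finset :=
  c.exists_isGreatest.choose_spec.1

theorem le_top (c : NonemptyFiniteChains P) {p : P} (hp : p ∈ c.finset) : p ≤ c.top :=
  c.exists_isGreatest.choose_spec.2 hp

theorem bot_map (c : NonemptyFiniteChains P) (f : P →o Q) : (c.map f).bot = f c.bot := by
  apply le_antisymm
  · exact bot_le _ ((mem_map_iff _ _ _).2 ⟨_, c.bot_mem, rfl⟩)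
  · obtain ⟨x, hx, h⟩ := (mem_map_iff _ _ _).1 (c.map f).bot_mem
    rw [← h]
    exact f.monotone (c.bot_le hx)

theorem top_map (c : NonemptyFiniteChains P) (f : P →o Q) : (c.map f).top = f c.top := by
  apply le_antisymm
  · obtain ⟨x, hx, h⟩ := (mem_map_iff _ _ _).1 (c.map f).top_mem
    rw [← h]
    exact f.monotone (c.le_top hx)
  · exact le_top _ ((mem_map_iff _ _ _).2 ⟨_, c.top_mem, rfl⟩)

theorem bot_anti {c d : NonemptyFiniteChains P} (h : c ≤ d) : d.bot ≤ c.bot :=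
  d.bot_le (h c.bot_mem)

theorem top_mono {c d : NonemptyFiniteChains P} (h : c ≤ d) : c.top ≤ d.top :=
  d.le_top (h c.top_mem)

end PartialOrder.NonemptyFiniteChains

/-! ### Partial decompositions and their joins -/

section Splitting

variable {G : Type} [Group G]

theorem Refines.sSup_le {c d : Set (Subgroup G)} (h : Refines c d) : sSup c ≤ sSup d := by
  refine _root_.sSup_le fun A hA => ?_
  obtain ⟨B, hB, hAB⟩ := h A hA
  exact hAB.trans (le_sSup hB)

theorem IsPartialDecomposition.isFreeFactor_sSup {d : Set (Subgroup G)}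
    (h : IsPartialDecomposition d) : IsFreeFactor (sSup d) := by
  rw [← freeProductMap_range]
  exact h.2.2.2.2

theorem IsPartialDecomposition.sSup_ne_bot {d : Set (Subgroup G)}
    (h : IsPartialDecomposition d) : sSup d ≠ ⊥ := by
  obtain ⟨A, hA⟩ := h.1
  intro h0
  exact (h.2.2.1 A hA).2.1 (le_bot_iff.1 (h0 ▸ le_sSup hA))

theorem IsPartialDecomposition.isFull_iff {d : Set (Subgroup G)}
    (h : IsPartialDecomposition d) : IsFullDecomposition d ↔ sSup d = ⊤ :=
  ⟨fun h => h.2, fun h2 => ⟨h, h2⟩⟩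

theorem IsPartialDecomposition.isProperFreeFactor_sSup {d : Set (Subgroup G)}
    (h : IsPartialDecomposition d) (h2 : ¬ IsFullDecomposition d) :
    IsProperFreeFactor (sSup d) :=
  ⟨h.isFreeFactor_sSup, h.sSup_ne_bot, fun h3 => h2 (h.isFull_iff.2 h3)⟩

/-- The projection of the free product onto the factor `A` is the identity on `A` and kills every
other factor. -/
theorem IsPartialDecomposition.eq_of_mem {d : Set (Subgroup G)} (hd : IsPartialDecomposition d)
    {A B : Subgroup G} (hA : A ∈ d) (hB : B ∈ d) {x : G} (hxA : x ∈ A) (hxB : x ∈ B)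
    (hx : x ≠ 1) : A = B := by
  classical
  by_contra hne
  have h1 : freeProductMap d (Monoid.CoprodI.of (i := (⟨A, hA⟩ : d)) ⟨x, hxA⟩) =
      freeProductMap d (Monoid.CoprodI.of (i := (⟨B, hB⟩ : d)) ⟨x, hxB⟩) := by
    simp [freeProductMap]
  have h2 := hd.2.2.2.1 h1
  have h3 := congrArg (Monoid.CoprodI.lift (Pi.mulSingle (⟨A, hA⟩ : d) (MonoidHom.id _))) h2
  have hne2 : (⟨B, hB⟩ : d) ≠ ⟨A, hA⟩ := fun h => hne (congrArg Subtype.val h).symm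
  rw [Monoid.CoprodI.of_leftInverse, Monoid.CoprodI.lift_of, Pi.mulSingle_eq_of_ne hne2] at h3
  exact hx (by simpa using congrArg Subtype.val h3)

/-- The non-trivial intersections of `B` with the members of `e`. -/
def splitting (B : Subgroup G) (e : Set (Subgroup G)) : Set (Subgroup G) :=
  {C | C ≠ ⊥ ∧ ∃ E ∈ e, C = B ⊓ E}

theorem splitting_refines_right (B : Subgroup G) (e : Set (Subgroup G)) :
    Refines (splitting B e) e := by
  rintro _ ⟨-, E, hE, rfl⟩
  exact ⟨E, hE, inf_le_right⟩

theorem splitting_refines_singleton {B C : Subgroup G} (h : B ≤ C) (e : Set (Subgroup G)) :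
    Refines (splitting B e) {C} := by
  rintro _ ⟨-, E, hE, rfl⟩
  exact ⟨C, rfl, inf_le_left.trans h⟩

theorem splitting_mono {B C : Subgroup G} (h : B ≤ C) (e : Set (Subgroup G)) :
    Refines (splitting B e) (splitting C e) := by
  rintro _ ⟨h0, E, hE, rfl⟩
  have hle : B ⊓ E ≤ C ⊓ E := inf_le_inf_right E h
  exact ⟨C ⊓ E, ⟨fun h1 => h0 (le_bot_iff.1 (h1 ▸ hle)), E, hE, rfl⟩, hle⟩

theorem IsPartialDecomposition.refines_splitting {d e : Set (Subgroup G)}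
    (hd : IsPartialDecomposition d) (h : Refines d e) : Refines d (splitting (sSup d) e) := by
  intro A hA
  obtain ⟨E, hE, hAE⟩ := h A hA
  have hle : A ≤ sSup d ⊓ E := le_inf (le_sSup hA) hAE
  exact ⟨_, ⟨fun h1 => (hd.2.2.1 A hA).2.1 (le_bot_iff.1 (h1 ▸ hle)), E, hE, rfl⟩, hle⟩

/-- Since `e` generates the group, the basis elements lying in members of `e` do too, so they are
all of them. Hence each basis element in `B` lies in some `B ⊓ E`. -/
theorem sSup_splitting {ι : Type} {b : FreeGroupBasis ι G} {e : Set (Subgroup G)}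
    (he : sSup e = ⊤) (hbe : ∀ E ∈ e, b.Spans E) {B : Subgroup G} (hB : b.Spans B) :
    sSup (splitting B e) = B := by
  apply le_antisymm
  · refine sSup_le ?_
    rintro _ ⟨-, E, hE, rfl⟩
    exact inf_le_left
  · refine hB.trans ((Subgroup.closure_le _).2 ?_)
    rintro _ ⟨i, hi, rfl⟩
    have h1 : b i ∈ Subgroup.closure (b '' {j | ∃ E ∈ e, b j ∈ E}) := by
      have h2 : sSup e ≤ Subgroup.closure (b '' {j | ∃ E ∈ e, b j ∈ E}) := by
        refine sSup_le fun E hE => (hbe E hE).trans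
          (Subgroup.closure_mono (Set.image_mono fun j hj => ⟨E, hE, hj⟩))
      rw [he] at h2
      exact h2 (Subgroup.mem_top _)
    obtain ⟨E, hE, hiE⟩ := (b.mem_closure_image_iff _ i).1 h1
    have hiBE : b i ∈ B ⊓ E := ⟨hi, hiE⟩
    have hmem : B ⊓ E ∈ splitting B e := by
      refine ⟨fun h0 => b.coe_ne_one i ?_, E, hE, rfl⟩
      rwa [h0, Subgroup.mem_bot] at hiBE
    exact le_sSup hmem hiBE

theorem isPartialDecomposition_splitting {ι : Type} {b : FreeGroupBasis ι G}
    {e : Set (Subgroup G)} (he : IsFullDecomposition e) (hbe : ∀ E ∈ e, b.Spans E)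
    {B : Subgroup G} (hB : b.Spans B) (hB0 : B ≠ ⊥) :
    IsPartialDecomposition (splitting B e) := by
  have hsup := sSup_splitting he.2 hbe hB
  have hspan : ∀ C ∈ splitting B e, b.Spans C := by
    rintro _ ⟨-, E, hE, rfl⟩
    exact hB.inf (hbe E hE)
  refine ⟨?_, ?_, ?_, FreeGroupBasis.freeProductMap_injective hspan ?_, ?_⟩
  · rw [Set.nonempty_iff_ne_empty]
    intro h
    rw [h, sSup_empty] at hsup
    exact hB0 hsup.symm
  · refine (he.1.2.1.image fun E => B ⊓ E).subset ?_
    rintro _ ⟨-, E, hE, rfl⟩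
    exact ⟨E, hE, rfl⟩
  · intro C hC
    refine ⟨(hspan C hC).isFreeFactor, hC.1, ?_⟩
    obtain ⟨-, E, hE, rfl⟩ := hC
    intro h
    exact (he.1.2.2.1 E hE).2.2 (top_le_iff.1 (h ▸ inf_le_right))
  · rintro _ ⟨-, E, hE, rfl⟩ _ ⟨-, E', hE', rfl⟩ i hi hi'
    rw [he.1.eq_of_mem hE hE' hi.2 hi'.2 (b.coe_ne_one i)]
  · rw [freeProductMap_range, hsup]
    exact hB.isFreeFactor

theorem IsProperFreeFactor.isPartialDecomposition_singleton {ι : Type}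
    (b : FreeGroupBasis ι G) {B : Subgroup G} (hB : IsProperFreeFactor B) :
    IsPartialDecomposition {B} := by
  obtain ⟨κ, a, -⟩ := b.exists_basis_subgroup B
  obtain ⟨μ, c, hc⟩ := b.exists_basis_of_isFreeFactor hB.1 a
  refine ⟨Set.singleton_nonempty _, Set.finite_singleton _, ?_,
    FreeGroupBasis.freeProductMap_injective (b := c) ?_ ?_, ?_⟩
  · rintro _ rfl
    exact hB
  · rintro _ rfl
    exact FreeGroupBasis.spans_of_forall_exists hc
  · rintro _ rfl _ rfl _ _ _
    rfl
  · rw [freeProductMap_range, sSup_singleton]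
    exact hB.1

end Splitting

/-! ### The map from chains of partial decompositions to `FCD_n` -/

namespace PD

variable {n : ℕ}

/-- The join of the smallest member of a chain, together with the largest member if it is full. -/
def toFCDFun (s : NonemptyFiniteChains (PD n)) : FCD n where
  factor := sSup s.bot.factors
  decomposition := {A | IsFullDecomposition s.top.factors ∧ A ∈ s.top.factors}
  compatible := by
    have hle : Refines s.bot.factors s.top.factors := s.bot_le s.top_mem
    by_cases h : IsFullDecomposition s.top.factors
    · simp only [h, true_and, Set.ofPred_mem_eq]
      by_cases h2 : IsFullDecomposition s.bot.factors
      · exact Or.inr (Or.inr ⟨h2.2, trivial⟩)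
      · have h3 := s.bot.isPartialDecomposition.isProperFreeFactor_sSup h2
        obtain ⟨c, hc, hc2⟩ :=
          -- A basis adapted to both ends of the chain spans the join of the smallest member as
          -- well.
          IsFullDecomposition.exists_spans s.bot.isPartialDecomposition h hle
        refine Or.inl ⟨h3, ⟨_, Or.inl rfl⟩, ?_, c, ?_⟩
        · rintro A (rfl | hA)
          · exact h3
          · exact h.1.2.2.1 A hA
        · rintro A (rfl | hA)
          · exact ⟨_, (FreeGroupBasis.spans_sSup hc).eq⟩
          · exact ⟨_, (hc2 A hA).eq⟩
    · refine Or.inr (Or.inl ⟨s.bot.isPartialDecomposition.isProperFreeFactor_sSup fun h2 => h ?_,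
        by simp [h]⟩)
      refine s.top.isPartialDecomposition.isFull_iff.2 (top_le_iff.1 ?_)
      rw [← h2.2]
      exact hle.sSup_le

theorem isFull_of_le {c d : PD n} (h : c ≤ d) (hc : IsFullDecomposition c.factors) :
    IsFullDecomposition d.factors := by
  refine d.isPartialDecomposition.isFull_iff.2 (top_le_iff.1 ?_)
  rw [← hc.2]
  exact Refines.sSup_le h

/-- The map `toFCDFun` as an order-preserving map. -/
def toFCD (n : ℕ) : NonemptyFiniteChains (PD n) →o FCD n where
  toFun := toFCDFun
  monotone' s t h := by
    refine ⟨Refines.sSup_le (NonemptyFiniteChains.bot_anti h), ?_⟩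
    rintro A ⟨h1, hA⟩
    have hle := NonemptyFiniteChains.top_mono h
    obtain ⟨B, hB, hAB⟩ := hle A hA
    exact ⟨B, ⟨isFull_of_le hle h1, hB⟩, hAB⟩

theorem isFull_smul_iff (g : MulAut (FreeGroupOfRank n)) (d : PD n) :
    IsFullDecomposition (g • d).factors ↔ IsFullDecomposition d.factors := by
  refine ⟨fun h => ?_, fun h => h.smul g⟩
  have := h.smul g⁻¹
  change IsFullDecomposition (g⁻¹ • g • d.factors) at this
  rwa [inv_smul_smul] at this

theorem toFCD_smul (g : MulAut (FreeGroupOfRank n)) (s : NonemptyFiniteChains (PD n)) :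
    toFCD n (g • s) = g • toFCD n s := by
  have hb : (g • s).bot = g • s.bot := NonemptyFiniteChains.bot_map _ _
  have ht : (g • s).top = g • s.top := NonemptyFiniteChains.top_map _ _
  apply FCD.ext
  · change sSup (g • s).bot.factors = g • sSup s.bot.factors
    rw [hb]
    exact sSup_smul_subgroup _ _
  · change {A | IsFullDecomposition (g • s).top.factors ∧ A ∈ (g • s).top.factors} =
      g • {A | IsFullDecomposition s.top.factors ∧ A ∈ s.top.factors}
    rw [ht]
    simp only [isFull_smul_iff]
    ext A
    rw [Set.mem_smul_set_iff_inv_smul_mem]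
    exact and_congr_right fun _ => Set.mem_smul_set_iff_inv_smul_mem

/-- The partial decompositions whose chains are mapped below `x`. -/
def fibre (x : FCD n) : Set (PD n) :=
  {d | x.factor ≤ sSup d.factors ∧
    (Refines d.factors x.decomposition ∨ ¬ IsFullDecomposition d.factors)}

/-- The bound on joins is hardest for the smallest member, the refinement condition for the largest;
fullness passes upwards along the chain. Thus {s | φ s ≤ x} is the poset of chains of `fibre x`. -/
theorem toFCD_le_iff (s : NonemptyFiniteChains (PD n)) (x : FCD n) :
    toFCD n s ≤ x ↔ ∀ d ∈ s.finset, d ∈ fibre x := by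
  constructor
  · rintro ⟨h1, h2⟩ d hd
    refine ⟨h1.trans (Refines.sSup_le (s.bot_le hd)), ?_⟩
    by_cases h : IsFullDecomposition s.top.factors
    · refine Or.inl (Refines.trans (s.le_top hd) fun A hA => h2 A ⟨h, hA⟩)
    · exact Or.inr fun h3 => h (isFull_of_le (s.le_top hd) h3)
  · intro h
    refine ⟨(h _ s.bot_mem).1, ?_⟩
    rintro A ⟨h1, hA⟩
    exact ((h _ s.top_mem).2.resolve_right (not_not.2 h1)) A hA

theorem exists_spans_of_isFullDecomposition (x : FCD n)
    (hx : IsFullDecomposition x.decomposition) :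
    ∃ b : FreeGroupBasis (Fin n) (FreeGroupOfRank n),
      b.Spans x.factor ∧ ∀ E ∈ x.decomposition, b.Spans E := by
  rcases x.compatible with ⟨-, -, -, -, b, hb⟩ | ⟨-, h⟩ | ⟨h, -⟩
  · have h : ∀ A ∈ {x.factor} ∪ x.decomposition, b.Spans A := by
      intro A hA
      obtain ⟨S, rfl⟩ := hb A hA
      exact b.spans_closure S
    exact ⟨b, h _ (Or.inl rfl), fun E hE => h _ (Or.inr hE)⟩
  · obtain ⟨A, hA⟩ := hx.1.1
    rw [h] at hA
    exact hA.elim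
  · obtain ⟨b, -, hb⟩ := IsFullDecomposition.exists_spans hx.1 hx (Refines.refl _)
    exact ⟨b, by rw [h]; exact b.spans_top, hb⟩

theorem decomposition_cases (x : FCD n) :
    IsFullDecomposition x.decomposition ∨ x.decomposition = ∅ ∧ IsProperFreeFactor x.factor := by
  rcases x.compatible with h | h | h
  · exact Or.inl h.2.1
  · exact Or.inr h.symm
  · exact Or.inl h.2

theorem factor_ne_bot (x : FCD n) : x.factor ≠ ⊥ := by
  rcases x.compatible with h | h | h
  · exact h.1.2.1
  · exact h.1.2.1
  · intro h0
    obtain ⟨A, hA⟩ := h.2.1.1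
    refine (h.2.1.2.2.1 A hA).2.1 (le_bot_iff.1 ?_)
    rw [← h0, h.1]
    exact le_top

open Classical in
/-- The factors of the value at `d` of a closure operator on `fibre x`. -/
def gatherFactors (x : FCD n) (d : PD n) : Set (Subgroup (FreeGroupOfRank n)) :=
  -- If `d` does not refine the decomposition then, within the fibre, it is not full, so its join is
  -- proper and is itself a one-member partial decomposition.
  if Refines d.factors x.decomposition then splitting (sSup d.factors) x.decomposition
  else {sSup d.factors}

theorem full_of_refines {x : FCD n} {d : PD n} (h : Refines d.factors x.decomposition) :
    IsFullDecomposition x.decomposition := by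
  refine (decomposition_cases x).resolve_right fun h2 => ?_
  obtain ⟨A, hA⟩ := d.isPartialDecomposition.1
  obtain ⟨B, hB, -⟩ := h A hA
  rw [h2.1] at hB
  exact hB

theorem gatherFactors_spec {x : FCD n} {d : PD n} (hd : d ∈ fibre x) :
    IsPartialDecomposition (gatherFactors x d) ∧ sSup (gatherFactors x d) = sSup d.factors := by
  rw [gatherFactors]
  split_ifs with h
  · have hx := full_of_refines h
    obtain ⟨b, hb, hb2⟩ := IsFullDecomposition.exists_spans d.isPartialDecomposition hx h
    have hb3 := FreeGroupBasis.spans_sSup hb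
    exact ⟨isPartialDecomposition_splitting hx hb2 hb3 d.isPartialDecomposition.sSup_ne_bot,
      sSup_splitting hx.2 hb2 hb3⟩
  · exact ⟨(d.isPartialDecomposition.isProperFreeFactor_sSup
      (hd.2.resolve_left h)).isPartialDecomposition_singleton
        (FreeGroupBasis.ofFreeGroup (Fin n)), sSup_singleton⟩

/-- A closure operator on `fibre x` whose values have a common lower bound. -/
def gather (x : FCD n) : fibre x →o fibre x where
  toFun d := ⟨⟨gatherFactors x d, (gatherFactors_spec d.2).1⟩, by
    have hs := gatherFactors_spec d.2
    refine ⟨d.2.1.trans hs.2.ge, ?_⟩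
    by_cases h : Refines d.1.factors x.decomposition
    · left
      simp only [gatherFactors, if_pos h]
      exact splitting_refines_right _ _
    · right
      intro h2
      refine d.2.2.resolve_left h (d.1.isPartialDecomposition.isFull_iff.2 ?_)
      rw [← hs.2]
      exact h2.2⟩
  monotone' c d hcd := by
    change Refines (gatherFactors x c) (gatherFactors x d)
    have hle : Refines c.1.factors d.1.factors := hcd
    rw [gatherFactors, gatherFactors]
    by_cases hd : Refines d.1.factors x.decomposition
    · rw [if_pos hd, if_pos (hle.trans hd)]
      exact splitting_mono hle.sSup_le _
    · rw [if_neg hd]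
      split_ifs
      · exact splitting_refines_singleton hle.sSup_le _
      · rintro _ rfl
        exact ⟨_, rfl, hle.sSup_le⟩

theorem le_gather (x : FCD n) (d : fibre x) : d ≤ gather x d := by
  change Refines d.1.factors (gatherFactors x d)
  rw [gatherFactors]
  split_ifs with h
  · exact d.1.isPartialDecomposition.refines_splitting h
  · exact fun A hA => ⟨_, rfl, le_sSup hA⟩

/-- The bound is the splitting of `x.factor` along the decomposition, or `{x.factor}` if that is
empty. Basis compatibility in `FCD` is what makes the splitting have join `x.factor`. -/
theorem exists_le_gather (x : FCD n) : ∃ c : fibre x, ∀ d, c ≤ gather x d := by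
  rcases decomposition_cases x with hx | ⟨hx, hx2⟩
  · obtain ⟨b, hb, hb2⟩ := exists_spans_of_isFullDecomposition x hx
    refine ⟨⟨⟨splitting x.factor x.decomposition,
      isPartialDecomposition_splitting hx hb2 hb (factor_ne_bot x)⟩,
      (sSup_splitting hx.2 hb2 hb).ge, Or.inl (splitting_refines_right _ _)⟩, fun d => ?_⟩
    change Refines (splitting x.factor x.decomposition) (gatherFactors x d)
    rw [gatherFactors]
    split_ifs
    · exact splitting_mono d.2.1 _
    · exact splitting_refines_singleton d.2.1 _
  · refine ⟨⟨⟨{x.factor}, hx2.isPartialDecomposition_singleton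
      (FreeGroupBasis.ofFreeGroup (Fin n))⟩, sSup_singleton.ge, Or.inr fun h => ?_⟩, fun d => ?_⟩
    · exact hx2.2.2 (sSup_singleton.symm.trans h.2)
    · change Refines {x.factor} (gatherFactors x d)
      have h : ¬ Refines d.1.factors x.decomposition := by
        intro h
        obtain ⟨A, hA⟩ := (full_of_refines h).1.1
        rw [hx] at hA
        exact hA
      rw [gatherFactors, if_neg h]
      rintro _ rfl
      exact ⟨_, rfl, d.2.1⟩

end PD

/-! ### Vertices, cones and simplices of an order complex -/

namespace OrderComplex

variable {P Q : Type*} [PartialOrder P] [PartialOrder Q]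

theorem support_nonempty (x : OrderComplex P) : x.weight.support.Nonempty := by
  rw [Finset.nonempty_iff_ne_empty]
  intro h
  have := x.sum_eq_one
  rw [Finsupp.sum, h, Finset.sum_empty] at this
  exact zero_ne_one this

/-- The support of a point, as a chain. -/
def chain (x : OrderComplex P) : NonemptyFiniteChains P where
  finset := x.weight.support
  nonempty := x.support_nonempty
  comparable a b := x.isChain.total a.2 b.2

theorem sum_weight {x : OrderComplex P} {s : Finset P} (h : x.weight.support ⊆ s) :
    ∑ a ∈ s, x.weight a = 1 := by
  rw [← x.sum_eq_one, Finsupp.sum_of_support_subset _ h _ fun _ _ => rfl]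

theorem weight_le_one (x : OrderComplex P) (a : P) : x.weight a ≤ 1 := by
  classical
  rw [← sum_weight (Finset.subset_insert a x.weight.support)]
  exact Finset.single_le_sum (fun b _ => x.nonneg b) (Finset.mem_insert_self _ _)

theorem weight_pos_iff {x : OrderComplex P} {a : P} :
    0 < x.weight a ↔ a ∈ x.weight.support := by
  rw [Finsupp.mem_support_iff]
  exact ⟨fun h => h.ne', fun h => lt_of_le_of_ne (x.nonneg a) h.symm⟩

theorem simplex_weight (c : NonemptyFiniteChains P) (v : stdSimplex ℝ c.finset) (a : c.finset) :
    (simplex c v).weight a = v.1 a :=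
  Finsupp.embDomain_apply_self (Function.Embedding.subtype (· ∈ c.finset))
    (Finsupp.equivFunOnFinite.symm v.1) a

theorem simplex_weight_of_notMem (c : NonemptyFiniteChains P) (v : stdSimplex ℝ c.finset) {a : P}
    (ha : a ∉ c.finset) : (simplex c v).weight a = 0 :=
  Finsupp.embDomain_of_notMem_range _ _ _ (by simpa using ha)

theorem mem_of_mem_support_simplex {c : NonemptyFiniteChains P} {v : stdSimplex ℝ c.finset}
    {a : P} (ha : a ∈ (simplex c v).weight.support) : a ∈ c.finset := by
  by_contra h
  exact Finsupp.mem_support_iff.1 ha (simplex_weight_of_notMem c v h)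

theorem continuous_simplex_weight (c : NonemptyFiniteChains P) (a : P) :
    Continuous fun v : stdSimplex ℝ c.finset => (simplex c v).weight a := by
  by_cases ha : a ∈ c.finset
  · have : (fun v : stdSimplex ℝ c.finset => (simplex c v).weight a) = fun v => v.1 ⟨a, ha⟩ :=
      funext fun v => simplex_weight c v ⟨a, ha⟩
    rw [this]
    exact (continuous_apply _).comp continuous_subtype_val
  · simp only [simplex_weight_of_notMem c _ ha]
    exact continuous_const

/-- The barycentric coordinates of a point that lies in the simplex of `c`. -/
def coords (c : NonemptyFiniteChains P) (x : OrderComplex P) (h : x.weight.support ⊆ c.finset) :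
    stdSimplex ℝ c.finset :=
  ⟨fun a => x.weight a, fun a => x.nonneg a, by
    rw [Finset.sum_coe_sort c.finset fun a => x.weight a]
    exact sum_weight h⟩

theorem simplex_coords (c : NonemptyFiniteChains P) (x : OrderComplex P)
    (h : x.weight.support ⊆ c.finset) : simplex c (coords c x h) = x := by
  apply OrderComplex.ext
  ext a
  by_cases ha : a ∈ c.finset
  · exact simplex_weight c _ ⟨a, ha⟩
  · rw [simplex_weight_of_notMem c _ ha]
    exact (Finsupp.notMem_support_iff.1 fun h2 => ha (h h2)).symm

theorem coords_simplex (c : NonemptyFiniteChains P) (v : stdSimplex ℝ c.finset) :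
    coords c (simplex c v) (fun _ => mem_of_mem_support_simplex) = v :=
  Subtype.ext (funext fun a => simplex_weight c v a)

/-- A vertex. -/
def vertex (p : P) : OrderComplex P where
  weight := Finsupp.single p 1
  nonneg a := by
    classical
    rw [Finsupp.single_apply]
    split_ifs
    · exact zero_le_one
    · exact le_rfl
  sum_eq_one := Finsupp.sum_single_index rfl
  isChain := by
    rw [Finsupp.support_single p one_ne_zero, Finset.coe_singleton]
    exact IsChain.singleton

theorem support_vertex (p : P) : (vertex p).weight.support = {p} :=
  Finsupp.support_single p one_ne_zero

theorem weight_vertex (p : P) : (vertex p).weight = Finsupp.single p 1 := rfl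

theorem eq_vertex {x : OrderComplex P} {p : P} (h : x.weight.support ⊆ {p}) : x = vertex p := by
  have h1 := sum_weight h
  rw [Finset.sum_singleton] at h1
  apply OrderComplex.ext
  rw [weight_vertex, Finsupp.eq_single_iff]
  exact ⟨h, h1⟩

/-- The point dividing the segment from `x` to the vertex `p` in the ratio `t : 1 - t`. -/
def cone (p : P) (x : OrderComplex P) (h : ∀ a ∈ x.weight.support, a ≤ p) (t : unitInterval) :
    OrderComplex P where
  weight := (1 - t : ℝ) • x.weight + (t : ℝ) • (vertex p).weight
  nonneg a := by
    have h1 := t.2.1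
    have h2 : (0 : ℝ) ≤ 1 - t := sub_nonneg.2 t.2.2
    have h3 := x.nonneg a
    have h4 := (vertex p).nonneg a
    rw [Finsupp.add_apply, Finsupp.smul_apply, Finsupp.smul_apply, smul_eq_mul, smul_eq_mul]
    positivity
  sum_eq_one := by
    rw [Finsupp.sum_add_index' (fun _ => rfl) (fun _ _ _ => rfl),
      Finsupp.sum_smul_index' (fun _ => rfl), Finsupp.sum_smul_index' (fun _ => rfl)]
    simp only [smul_eq_mul]
    rw [← Finsupp.mul_sum, ← Finsupp.mul_sum, x.sum_eq_one, (vertex p).sum_eq_one]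
    ring
  isChain := by
    classical
    refine IsChain.mono (t := insert p (x.weight.support : Set P)) ?_
      (x.isChain.insert fun b hb _ => Or.inr (h b hb))
    intro a ha
    have h1 := Finsupp.support_add ha
    rw [Finset.mem_union] at h1
    rcases h1 with h1 | h1
    · exact Or.inr (Finsupp.support_smul h1)
    · have h2 := Finsupp.support_smul h1
      rw [support_vertex, Finset.mem_singleton] at h2
      exact Or.inl h2

variable {p : P} {x : OrderComplex P} (h : ∀ a ∈ x.weight.support, a ≤ p)

theorem cone_weight (t : unitInterval) (a : P) :
    (cone p x h t).weight a = (1 - t) * x.weight a + t * (vertex p).weight a := rfl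

theorem mem_support_cone {t : unitInterval} {a : P} (ha : a ∈ (cone p x h t).weight.support) :
    a = p ∨ a ∈ x.weight.support := by
  classical
  by_contra! h2
  rw [Finsupp.mem_support_iff, cone_weight, Finsupp.notMem_support_iff.1 h2.2, weight_vertex,
    Finsupp.single_eq_of_ne h2.1] at ha
  simp at ha

theorem le_of_mem_support_cone {t : unitInterval} {a : P}
    (ha : a ∈ (cone p x h t).weight.support) : a ≤ p := by
  rcases mem_support_cone h ha with rfl | ha
  · exact le_rfl
  · exact h a ha

theorem cone_zero : cone p x h 0 = x := by
  apply OrderComplex.ext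
  ext a
  simp [cone_weight]

theorem cone_one : cone p x h 1 = vertex p := by
  apply OrderComplex.ext
  ext a
  simp [cone_weight]

theorem mem_support_cone_self {t : unitInterval} (ht : 0 < t) :
    p ∈ (cone p x h t).weight.support := by
  have h0 : (0 : ℝ) < t := ht
  have h2 : (0 : ℝ) ≤ 1 - t := sub_nonneg.2 t.2.2
  have h3 := x.nonneg p
  rw [← weight_pos_iff, cone_weight, weight_vertex, Finsupp.single_eq_same]
  positivity

theorem mem_support_cone_of_mem {t : unitInterval} (ht : t < 1) {a : P}
    (ha : a ∈ x.weight.support) : a ∈ (cone p x h t).weight.support := by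
  have h0 : (0 : ℝ) ≤ t := t.2.1
  have h2 : (0 : ℝ) < 1 - t := sub_pos.2 ht
  have h3 := weight_pos_iff.2 ha
  have h4 := (vertex p).nonneg a
  rw [← weight_pos_iff, cone_weight]
  positivity

/-- The apex is the greatest element of the support and the parameter is its weight; dividing the
other weights by `1 - t` recovers the base point. -/
theorem cone_injective {q : P} {y : OrderComplex P} (hx : ∀ a ∈ x.weight.support, a < p)
    (hy : ∀ a ∈ y.weight.support, a < q) {t u : unitInterval} (ht : 0 < t) (ht1 : t < 1)
    (hu : 0 < u)
    (e : cone p x (fun a ha => (hx a ha).le) t = cone q y (fun a ha => (hy a ha).le) u) :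
    p = q ∧ x = y ∧ t = u := by
  have hpq : p = q := by
    apply le_antisymm
    · have h1 := mem_support_cone_self (fun a ha => (hx a ha).le) ht
      rw [e] at h1
      exact le_of_mem_support_cone _ h1
    · have h1 := mem_support_cone_self (fun a ha => (hy a ha).le) hu
      rw [← e] at h1
      exact le_of_mem_support_cone _ h1
  subst hpq
  have hxp : x.weight p = 0 := Finsupp.notMem_support_iff.1 fun h => lt_irrefl _ (hx p h)
  have hyp : y.weight p = 0 := Finsupp.notMem_support_iff.1 fun h => lt_irrefl _ (hy p h)
  have hw : ∀ a, (1 - t : ℝ) * x.weight a + t * (vertex p).weight a =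
      (1 - u) * y.weight a + u * (vertex p).weight a := fun a =>
    DFunLike.congr_fun (congrArg weight e) a
  have htu : t = u := by
    have := hw p
    rw [hxp, hyp, weight_vertex, Finsupp.single_eq_same] at this
    exact Subtype.ext (by linarith)
  subst htu
  refine ⟨rfl, OrderComplex.ext (Finsupp.ext fun a => ?_), rfl⟩
  have h2 : (1 - t : ℝ) ≠ 0 := (sub_pos.2 (show (t : ℝ) < 1 from ht1)).ne'
  exact mul_left_cancel₀ h2 (add_right_cancel (hw a))

theorem exists_eq_cone (x : OrderComplex P) : (∃ p, x = vertex p) ∨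
    ∃ (p : P) (y : OrderComplex P) (h : ∀ a ∈ y.weight.support, a < p) (t : unitInterval),
      0 < t ∧ t < 1 ∧ x = cone p y (fun a ha => (h a ha).le) t := by
  classical
  -- The apex is the top of the support. Unless it has weight 1, the rest is rescaled to total
  -- weight 1.
  set p := x.chain.top with hp
  have hpx : p ∈ x.weight.support := x.chain.top_mem
  have hle : ∀ a ∈ x.weight.support, a ≤ p := fun a ha => x.chain.le_top ha
  have hpos : 0 < x.weight p := weight_pos_iff.2 hpx
  rcases (x.weight_le_one p).eq_or_lt with h1 | h1
  · refine Or.inl ⟨p, eq_vertex fun a ha => ?_⟩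
    rw [Finset.mem_singleton]
    by_contra hne
    have h2 := sum_weight (x := x) (Finset.Subset.refl _)
    rw [← Finset.add_sum_erase _ _ hpx, h1, add_eq_left,
      Finset.sum_eq_zero_iff_of_nonneg fun b _ => x.nonneg b] at h2
    exact Finsupp.mem_support_iff.1 ha (h2 a (Finset.mem_erase.2 ⟨hne, ha⟩))
  · have h2 : 0 < 1 - x.weight p := sub_pos.2 h1
    have hs : ∀ a ∈ ((1 - x.weight p)⁻¹ • x.weight.erase p).support,
        a ≠ p ∧ a ∈ x.weight.support := by
      intro a ha
      have := Finsupp.support_smul ha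
      rw [Finsupp.support_erase] at this
      exact Finset.mem_erase.1 this
    let y : OrderComplex P :=
      { weight := (1 - x.weight p)⁻¹ • x.weight.erase p
        nonneg := fun a => by
          have h3 := x.nonneg a
          rw [Finsupp.smul_apply, Finsupp.erase_apply, smul_eq_mul]
          split_ifs <;> positivity
        sum_eq_one := by
          rw [Finsupp.sum_smul_index' (fun _ => rfl)]
          simp only [smul_eq_mul]
          rw [← Finsupp.mul_sum, inv_mul_eq_one₀ h2.ne', Finsupp.sum, Finsupp.support_erase]
          have h3 := sum_weight (x := x) (Finset.Subset.refl _)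
          rw [← Finset.add_sum_erase _ _ hpx] at h3
          rw [Finset.sum_congr rfl fun a ha =>
            (Finsupp.erase_ne (Finset.ne_of_mem_erase ha) : _ = x.weight a)]
          linarith
        isChain := x.isChain.mono fun a ha => (hs a ha).2 }
    have hy : ∀ a ∈ y.weight.support, a < p := fun a ha =>
      lt_of_le_of_ne (hle a (hs a ha).2) (hs a ha).1
    refine Or.inr ⟨p, y, hy, ⟨x.weight p, hpos.le, h1.le⟩, hpos, h1, ?_⟩
    apply OrderComplex.ext
    ext a
    rw [cone_weight]
    change x.weight a = (1 - x.weight p) * ((1 - x.weight p)⁻¹ * x.weight.erase p a) + _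
    rw [mul_inv_cancel_left₀ h2.ne', weight_vertex]
    by_cases ha : a = p
    · subst ha
      simp
    · rw [Finsupp.erase_ne ha, Finsupp.single_eq_of_ne ha]
      simp

theorem card_support_lt_cone (hx : ∀ a ∈ x.weight.support, a < p) {t : unitInterval}
    (ht : 0 < t) (ht1 : t < 1) :
    x.weight.support.card < (cone p x (fun a ha => (hx a ha).le) t).weight.support.card := by
  refine Finset.card_lt_card ⟨fun a ha => mem_support_cone_of_mem _ ht1 ha, fun h2 => ?_⟩
  exact lt_irrefl _ (hx p (h2 (mem_support_cone_self _ ht)))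

/-- Induction along the greatest elements of the supports. -/
theorem cone_induction {motive : OrderComplex P → Prop} (vertex : ∀ p, motive (vertex p))
    (cone : ∀ (p : P) (x : OrderComplex P) (h : ∀ a ∈ x.weight.support, a < p) (t : unitInterval),
      0 < t → t < 1 → motive x → motive (cone p x (fun a ha => (h a ha).le) t))
    (x : OrderComplex P) : motive x := by
  induction hn : x.weight.support.card using Nat.strong_induction_on generalizing x with
  | _ n ih =>
    rcases x.exists_eq_cone with ⟨p, rfl⟩ | ⟨p, y, hy, t, ht, ht1, rfl⟩
    · exact vertex p
    · exact cone p y hy t ht ht1 (ih _ (hn ▸ card_support_lt_cone hy ht ht1) y rfl)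

/-- Recursion along the greatest elements of the supports. -/
theorem exists_cone_rec {Z : Type*} (a : P → Z)
    (step : ∀ (p : P) (x : OrderComplex P), (∀ a ∈ x.weight.support, a < p) →
      unitInterval → Z → Z) :
    ∃ f : OrderComplex P → Z, (∀ p, f (vertex p) = a p) ∧
      ∀ (p : P) (x : OrderComplex P) (h : ∀ a ∈ x.weight.support, a < p) (t : unitInterval),
        0 < t → t < 1 → f (cone p x (fun a ha => (h a ha).le) t) = step p x h t (f x) := by
  classical
  have hD : ∀ x : OrderComplex P, (¬ ∃ p, x = vertex p) →
      ∃ e : P × OrderComplex P × unitInterval, ∃ h : ∀ a ∈ e.2.1.weight.support, a < e.1,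
        0 < e.2.2 ∧ e.2.2 < 1 ∧ x = cone e.1 e.2.1 (fun a ha => (h a ha).le) e.2.2 := by
    intro x hx
    obtain ⟨p, y, hy, t, h⟩ := x.exists_eq_cone.resolve_left hx
    exact ⟨⟨p, y, t⟩, hy, h⟩
  choose D hD1 hD2 hD3 hD4 using hD
  have hlt : ∀ x hx, (D x hx).2.1.weight.support.card < x.weight.support.card := by
    intro x hx
    conv_rhs => rw [hD4 x hx]
    exact card_support_lt_cone (hD1 x hx) (hD2 x hx) (hD3 x hx)
  let F : ∀ x : OrderComplex P,
      (∀ y : OrderComplex P, y.weight.support.card < x.weight.support.card → Z) → Z :=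
    fun x rec => if hx : ∃ p, x = vertex p then a hx.choose
      else step (D x hx).1 (D x hx).2.1 (hD1 x hx) (D x hx).2.2 (rec (D x hx).2.1 (hlt x hx))
  let f := (measure fun x : OrderComplex P => x.weight.support.card).wf.fix F
  have hf : ∀ x, f x = F x fun y _ => f y := fun x => WellFounded.fix_eq _ _ _
  refine ⟨f, fun p => ?_, fun p x h t ht ht1 => ?_⟩
  · have hx : ∃ q, vertex p = vertex q := ⟨p, rfl⟩
    rw [hf]
    simp only [F, dif_pos hx]
    congr 1
    have := congrArg (fun x => x.weight.support) hx.choose_spec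
    simp only [support_vertex, Finset.singleton_inj] at this
    exact this.symm
  · have hx : ¬ ∃ q, cone p x (fun a ha => (h a ha).le) t = vertex q := by
      rintro ⟨q, hq⟩
      obtain ⟨b, hb⟩ := x.support_nonempty
      have h1 := mem_support_cone_self (fun a ha => (h a ha).le) ht
      have h2 := mem_support_cone_of_mem (fun a ha => (h a ha).le) ht1 hb
      rw [hq, support_vertex, Finset.mem_singleton] at h1 h2
      exact (h b hb).ne (h2.trans h1.symm)
    rw [hf]
    simp only [F, dif_neg hx]
    -- The chosen cone presentation must be the given one.
    obtain ⟨e1, e2, e3⟩ := cone_injective h (hD1 _ hx) ht ht1 (hD2 _ hx) (hD4 _ hx)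
    generalize hD1 _ hx = hh
    revert hh
    rw [← e1, ← e2, ← e3]
    intro hh
    rfl

end OrderComplex

/-! ### Continuity of maps defined on an order complex -/

namespace OrderComplex

variable {P Q : Type*} [PartialOrder P] [PartialOrder Q]

open Classical in
/-- The chain obtained by adding an upper bound. -/
def insertTop (c : NonemptyFiniteChains P) (p : P) (h : ∀ a ∈ c.finset, a ≤ p) :
    NonemptyFiniteChains P where
  finset := insert p c.finset
  nonempty := Finset.insert_nonempty _ _
  comparable := by
    rintro ⟨a, ha⟩ ⟨b, hb⟩
    change a ≤ b ∨ b ≤ a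
    rw [Finset.mem_insert] at ha hb
    rcases ha with rfl | ha
    · rcases hb with rfl | hb
      · exact Or.inl le_rfl
      · exact Or.inr (h b hb)
    · rcases hb with rfl | hb
      · exact Or.inl (h a ha)
      · exact c.comparable ⟨a, ha⟩ ⟨b, hb⟩

theorem mem_insertTop {c : NonemptyFiniteChains P} {p : P} {h : ∀ a ∈ c.finset, a ≤ p} {a : P} :
    a ∈ (insertTop c p h).finset ↔ a = p ∨ a ∈ c.finset := by
  classical
  exact Finset.mem_insert

variable {c : NonemptyFiniteChains P} {p : P}

/-- The cone with apex `p` over the simplex of `c`, in coordinates. -/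
def coneCoords (h : ∀ a ∈ c.finset, a ≤ p) (w : stdSimplex ℝ c.finset × unitInterval) :
    stdSimplex ℝ (insertTop c p h).finset :=
  coords _ (cone p (simplex c w.1) (fun a ha => h a (mem_of_mem_support_simplex ha)) w.2)
    fun _ ha => mem_insertTop.2 <|
      (mem_support_cone _ ha).imp_right mem_of_mem_support_simplex

theorem simplex_coneCoords (h : ∀ a ∈ c.finset, a ≤ p)
    (w : stdSimplex ℝ c.finset × unitInterval) : simplex _ (coneCoords h w) =
      cone p (simplex c w.1) (fun a ha => h a (mem_of_mem_support_simplex ha)) w.2 :=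
  simplex_coords _ _ _

theorem continuous_coneCoords (h : ∀ a ∈ c.finset, a ≤ p) : Continuous (coneCoords h) := by
  refine Continuous.subtype_mk (continuous_pi fun a => ?_) _
  simp only [cone_weight]
  have h1 := (continuous_simplex_weight c (a : P)).comp
    (continuous_fst (X := stdSimplex ℝ c.finset) (Y := unitInterval))
  have h2 : Continuous fun w : stdSimplex ℝ c.finset × unitInterval => (w.2 : ℝ) :=
    continuous_subtype_val.comp continuous_snd
  exact ((continuous_const.sub h2).mul h1).add (h2.mul continuous_const)

theorem continuous_cone_simplex (h : ∀ a ∈ c.finset, a ≤ p) :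
    Continuous fun w : stdSimplex ℝ c.finset × unitInterval =>
      cone p (simplex c w.1) (fun a ha => h a (mem_of_mem_support_simplex ha)) w.2 := by
  simp only [← simplex_coneCoords]
  exact (continuous_simplex _).comp (continuous_coneCoords h)

theorem coneCoords_surjective (h : ∀ a ∈ c.finset, a < p) :
    Function.Surjective (coneCoords fun a ha => (h a ha).le) := by
  intro v
  suffices H : ∃ w : stdSimplex ℝ c.finset × unitInterval,
      cone p (simplex c w.1) (fun a ha => (h a (mem_of_mem_support_simplex ha)).le) w.2 =
        simplex _ v by
    obtain ⟨w, hw⟩ := H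
    refine ⟨w, ?_⟩
    rw [← coords_simplex _ v, coneCoords]
    congr 1
  have hv : ∀ a ∈ (simplex _ v).weight.support, a = p ∨ a ∈ c.finset := fun a ha =>
    mem_insertTop.1 (mem_of_mem_support_simplex ha)
  rcases (simplex _ v).exists_eq_cone with ⟨q, hq⟩ | ⟨q, y, hy, t, ht, ht1, e⟩
  · rw [hq] at hv ⊢
    rcases hv q (by simp [support_vertex]) with rfl | hqc
    · have : Nonempty c.finset := c.nonempty.to_subtype
      exact ⟨⟨Classical.arbitrary _, 1⟩, cone_one _⟩
    · refine ⟨⟨coords c (vertex q) (by simpa [support_vertex] using hqc), 0⟩, ?_⟩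
      rw [cone_zero, simplex_coords]
  · by_cases hqp : q = p
    · subst hqp
      rw [e] at hv ⊢
      have hyc : y.weight.support ⊆ c.finset := fun a ha =>
        (hv a (mem_support_cone_of_mem _ ht1 ha)).resolve_left (hy a ha).ne
      refine ⟨⟨coords c y hyc, t⟩, ?_⟩
      congr 1
      exact simplex_coords c y hyc
    · refine ⟨⟨coords c (simplex _ v) fun a ha => ?_, 0⟩, ?_⟩
      · refine (hv a ha).resolve_left ?_
        rintro rfl
        have h1 := hv q (by rw [e]; exact mem_support_cone_self _ ht)
        have h2 : a ≤ q := by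
          rw [e] at ha
          exact le_of_mem_support_cone _ ha
        rcases h1 with h1 | h1
        · exact hqp h1
        · exact lt_irrefl _ (h2.trans_lt (h q h1))
      · rw [cone_zero, simplex_coords]

variable {T Z : Type*} [TopologicalSpace T] [TopologicalSpace Z]

/-- Continuity on the product with a locally compact space can be checked on simplices. -/
theorem continuous_prod_of_simplex [LocallyCompactSpace T] {f : OrderComplex P × T → Z}
    (h : ∀ c : NonemptyFiniteChains P,
      Continuous fun w : stdSimplex ℝ c.finset × T => f (simplex c w.1, w.2)) :
    Continuous f := by
  have h1 : ∀ x, Continuous fun t => f (x, t) := by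
    intro x
    have := (h x.chain).comp (Continuous.prodMk_right (coords x.chain x (Finset.Subset.refl _)))
    exact this.congr fun t => congrArg (fun y => f (y, t))
      (simplex_coords x.chain x (Finset.Subset.refl _))
  -- Currying avoids the product topology: continuity into `C(T, Z)` is tested on simplices, and
  -- local compactness of `T` permits uncurrying.
  let F : OrderComplex P → C(T, Z) := fun x => ⟨fun t => f (x, t), h1 x⟩
  have hF : Continuous F := by
    rw [continuous_dom_iff]
    intro c
    exact (ContinuousMap.curry ⟨_, h c⟩).continuous
  exact ContinuousMap.continuous_uncurry_of_continuous ⟨F, hF⟩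

/-- Continuity on the product with a compact space can be checked on cones. -/
theorem continuous_of_cone [CompactSpace T] [T2Space T] {f : OrderComplex P × T → Z}
    (hv : ∀ p, Continuous fun t => f (vertex p, t))
    (hc : ∀ (c : NonemptyFiniteChains P) (p : P) (h : ∀ a ∈ c.finset, a < p),
      (Continuous fun w : stdSimplex ℝ c.finset × T => f (simplex c w.1, w.2)) →
      Continuous fun w : (stdSimplex ℝ c.finset × unitInterval) × T =>
        f (cone p (simplex c w.1.1)
          (fun a ha => (h a (mem_of_mem_support_simplex ha)).le) w.1.2, w.2)) :
    Continuous f := by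
  classical
  refine continuous_prod_of_simplex fun c => ?_
  induction hn : c.finset.card using Nat.strong_induction_on generalizing c with
  | _ n ih =>
    by_cases hs : c.finset.erase c.top = ∅
    · have h1 : ∀ v : stdSimplex ℝ c.finset, simplex c v = vertex c.top := fun v =>
        eq_vertex fun a ha => by
          by_contra h
          rw [Finset.mem_singleton] at h
          have := Finset.mem_erase.2 ⟨h, mem_of_mem_support_simplex ha⟩
          rw [hs] at this
          exact Finset.notMem_empty _ this
      simp only [h1]
      exact (hv _).comp continuous_snd
    · let c' : NonemptyFiniteChains P :=
        { finset := c.finset.erase c.top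
          nonempty := Finset.nonempty_iff_ne_empty.2 hs
          comparable := fun a b =>
            c.comparable ⟨a, Finset.mem_of_mem_erase a.2⟩ ⟨b, Finset.mem_of_mem_erase b.2⟩ }
      have hlt : ∀ a ∈ c'.finset, a < c.top := fun a ha =>
        lt_of_le_of_ne (c.le_top (Finset.mem_of_mem_erase ha)) (Finset.ne_of_mem_erase ha)
      have hcc : c = insertTop c' c.top fun a ha => (hlt a ha).le := by
        apply NonemptyFiniteChains.ext
        exact (Finset.insert_erase c.top_mem).symm
      have h2 := hc c' c.top hlt
        (ih _ (hn ▸ Finset.card_erase_lt_of_mem c.top_mem) c' rfl)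
      rw [hcc]
      set q : (stdSimplex ℝ c'.finset × unitInterval) × T →
        stdSimplex ℝ (insertTop c' c.top fun a ha => (hlt a ha).le).finset × T :=
        Prod.map (coneCoords fun a ha => (hlt a ha).le) id with hq
      have hqc : Continuous q := (continuous_coneCoords _).prodMap continuous_id
      have hqs : Function.Surjective q :=
        (coneCoords_surjective hlt).prodMap Function.surjective_id
      -- The cone parametrization has compact source and Hausdorff target, so it is a quotient map
      -- and continuity may be tested before collapsing.
      rw [(hqc.isClosedMap.isQuotientMap hqc hqs).continuous_iff]
      refine h2.congr fun w => ?_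
      simp only [Function.comp_apply, hq, Prod.map_fst, Prod.map_snd, simplex_coneCoords, id]

end OrderComplex

/-! ### Maps carried by contractible subspaces -/

/-- The contraction is extended to all of `X` by an arbitrary value off `C`, so that recursive
constructions need not carry membership proofs. -/
theorem exists_contraction {X : Type*} [TopologicalSpace X] (C : Set X) [ContractibleSpace C] :
    ∃ (H : X → unitInterval → X) (a : X), a ∈ C ∧ (∀ z ∈ C, H z 0 = z) ∧ (∀ z ∈ C, H z 1 = a) ∧
      (∀ z ∈ C, ∀ t, H z t ∈ C) ∧
      ContinuousOn (fun w : X × unitInterval => H w.1 w.2) (C ×ˢ Set.univ) := by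
  classical
  obtain ⟨a, ⟨h⟩⟩ := id_nullhomotopic C
  let H : X → unitInterval → X := fun z t => if hz : z ∈ C then (h (t, ⟨z, hz⟩) : C) else z
  have hH : ∀ z (hz : z ∈ C) t, H z t = h (t, ⟨z, hz⟩) := fun z hz t => dif_pos hz
  refine ⟨H, a, a.2, fun z hz => ?_, fun z hz => ?_, fun z hz t => ?_, ?_⟩
  · rw [hH z hz, h.apply_zero]
    rfl
  · rw [hH z hz, h.apply_one]
    rfl
  · rw [hH z hz]
    exact Subtype.coe_prop _
  · rw [continuousOn_iff_continuous_domRestrict]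
    have h1 : Continuous fun w : (C ×ˢ Set.univ : Set (X × unitInterval)) =>
        (h (w.1.2, ⟨w.1.1, w.2.1⟩) : X) := by
      refine continuous_subtype_val.comp (h.continuous.comp ?_)
      exact (continuous_snd.comp continuous_subtype_val).prodMk
        ((continuous_fst.comp continuous_subtype_val).subtype_mk _)
    exact h1.congr fun w => (hH _ w.2.1 _).symm

namespace OrderComplex

variable {P X : Type*} [PartialOrder P] [TopologicalSpace X]

/-- The map `f` sends every simplex with vertices below `p` into `C p`. -/
def IsCarried (C : P → Set X) (f : OrderComplex P → X) : Prop :=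
  ∀ x p, (∀ a ∈ x.weight.support, a ≤ p) → f x ∈ C p

/-- The map `t ↦ min (2 * t) 1` of the unit interval. -/
def double (t : unitInterval) : unitInterval := Set.projIcc 0 1 zero_le_one (2 * t)

theorem continuous_double : Continuous double :=
  continuous_projIcc.comp (continuous_const.mul continuous_subtype_val)

theorem double_zero : double 0 = 0 := by
  rw [double]
  exact Set.projIcc_of_le_left _ (by simp)

theorem double_of_half_le {t : unitInterval} (h : 1 / 2 ≤ (t : ℝ)) : double t = 1 :=
  Set.projIcc_of_right_le _ (by linarith)

theorem double_one : double 1 = 1 := double_of_half_le (by norm_num)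

/-- Maps carried by contractible subspaces exist and are unique up to homotopy. -/
theorem exists_isCarried {C : P → Set X} (hC : Monotone C) [∀ p, ContractibleSpace (C p)] :
    ∃ f : C(OrderComplex P, X), IsCarried C f ∧
      ∀ g : C(OrderComplex P, X), IsCarried C g → ContinuousMap.Homotopic g f := by
  choose H a ha H0 H1 HC Hc using fun p => exists_contraction (C p)
  -- On a cone with apex `p`, the value at the base is contracted to `a p` during the first half and
  -- stays there. The idle half leaves room for the homotopy below.
  obtain ⟨f, f1, f2⟩ := exists_cone_rec (Z := X) a fun p _ _ t z => H p z (double t)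
  have fC : IsCarried C f := by
    intro x
    induction x using cone_induction with
    | vertex q =>
      intro p hp
      rw [f1]
      exact hC (hp q (by simp [support_vertex])) (ha q)
    | cone q y h t ht ht1 ih =>
      intro p hp
      rw [f2 q y h t ht ht1]
      exact hC (hp q (mem_support_cone_self _ ht)) (HC q _ (ih q fun b hb => (h b hb).le) _)
  -- The recursion formula agrees with the values already assigned at the base and the apex, as
  -- continuity on cones requires.
  have f3 : ∀ (p : P) (x : OrderComplex P) (h : ∀ b ∈ x.weight.support, b < p)
      (t : unitInterval), f (cone p x (fun b hb => (h b hb).le) t) = H p (f x) (double t) := by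
    intro p x h t
    have hx := fC x p fun b hb => (h b hb).le
    rcases eq_or_lt_of_le (show 0 ≤ t from t.2.1) with rfl | ht
    · rw [cone_zero, double_zero, H0 p _ hx]
    rcases eq_or_lt_of_le (show t ≤ 1 from t.2.2) with rfl | ht1
    · rw [cone_one, double_one, H1 p _ hx, f1]
    exact f2 p x h t ht ht1
  have fcont : Continuous f := by
    have : Continuous fun w : OrderComplex P × Unit => f w.1 := by
      refine continuous_of_cone (fun p => continuous_of_const fun _ _ => rfl) fun c p h hc => ?_
      simp only [f3 p _ fun b hb => h b (mem_of_mem_support_simplex hb)]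
      refine (Hc p).comp_continuous (f := fun w : (stdSimplex ℝ c.finset × unitInterval) × Unit =>
        (f (simplex c w.1.1), double w.1.2)) ?_ fun w => ⟨fC _ p fun b hb =>
          (h b (mem_of_mem_support_simplex hb)).le, trivial⟩
      refine Continuous.prodMk ?_ (continuous_double.comp (continuous_snd.comp continuous_fst))
      have h1 : Continuous fun w : (stdSimplex ℝ c.finset × unitInterval) × Unit =>
          (w.1.1, w.2) := (continuous_fst.comp continuous_fst).prodMk continuous_snd
      have h2 := hc.comp h1
      simpa only [Function.comp_def] using h2
    exact this.comp (Continuous.prodMk_left ())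
  refine ⟨⟨f, fcont⟩, fC, fun g gC => ?_⟩
  -- The sign of `β` separates the cone parameter `t` from the time `s`. The second factor gives `β
  -- ≥ 1` for `t = 1`, `s ≤ 1/2` and `β ≤ -1` for `s = 1`, `t ≤ 1/2`; `β` equals `t` at `s = 0` and
  -- `-s` at `t = 0`.
  obtain ⟨β, hβ⟩ : ∃ β : unitInterval → unitInterval → ℝ,
      ∀ t s, β t s = (t - s) * (1 + 2 * min (t : ℝ) s) := ⟨_, fun _ _ => rfl⟩
  have βcont : Continuous fun w : unitInterval × unitInterval => β w.1 w.2 := by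
    simp only [hβ]
    fun_prop
  obtain ⟨pr, hpr, pr0, pr1, prt⟩ : ∃ pr : ℝ → unitInterval, Continuous pr ∧ pr 0 = 0 ∧
      (∀ r, 1 ≤ r → pr r = 1) ∧ ∀ t : unitInterval, pr t = t :=
    ⟨Set.projIcc 0 1 zero_le_one, continuous_projIcc, Set.projIcc_left _,
      fun r hr => Set.projIcc_of_right_le _ hr, fun t => Set.projIcc_val _ t⟩
  -- The homotopy from `g` to `f`: for `t ≥ s` it starts from `g` on the cone, for `t < s` from the
  -- homotopy on the base, and it then contracts in `C p` by an amount that vanishes at `t = 0` and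
  -- at `s = 0`.
  obtain ⟨K, K1, K2⟩ := exists_cone_rec (Z := unitInterval → X)
    (fun p s => H p (g (vertex p)) (double s))
    fun p x h t k s => H p (if 0 ≤ β t s
      then g (cone p x (fun b hb => (h b hb).le) (pr (β t s))) else k (pr (-β t s)))
      (double (min t s))
  replace K1 := fun p s => congrFun (K1 p) s
  replace K2 := fun p x h t ht ht1 s => congrFun (K2 p x h t ht ht1) s
  have gC1 : ∀ (p : P) (x : OrderComplex P) (h : ∀ b ∈ x.weight.support, b ≤ p) t,
      g (cone p x h t) ∈ C p := fun p x h t =>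
    gC _ _ fun b hb => le_of_mem_support_cone h hb
  have gv : ∀ p, g (vertex p) ∈ C p := fun p => gC _ _ fun b hb => by
    rw [support_vertex, Finset.mem_singleton] at hb
    exact hb.le
  have KC : ∀ s, IsCarried C fun x => K x s := by
    intro s x
    induction x using cone_induction generalizing s with
    | vertex q =>
      intro p hp
      simp only [K1]
      exact hC (hp q (by simp [support_vertex])) (HC q _ (gv q) _)
    | cone q y h t ht ht1 ih =>
      intro p hp
      simp only [K2 q y h t ht ht1]
      refine hC (hp q (mem_support_cone_self _ ht)) (HC q _ ?_ _)
      split_ifs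
      · exact gC1 _ _ _ _
      · exact ih _ q fun b hb => (h b hb).le
  have K0 : ∀ x, K x 0 = g x := by
    intro x
    induction x using cone_induction with
    | vertex q => rw [K1, double_zero, H0 q _ (gv q)]
    | cone q y h t ht ht1 ih =>
      have h1 : β t 0 = t := by
        simp [hβ, t.2.1]
      have h2 : min t 0 = 0 := min_eq_right t.2.1
      rw [K2 q y h t ht ht1, h1, h2, if_pos t.2.1, double_zero, prt, H0 q _ (gC1 _ _ _ _)]
  have K3 : ∀ (p : P) (x : OrderComplex P) (h : ∀ b ∈ x.weight.support, b < p)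
      (t s : unitInterval), K (cone p x (fun b hb => (h b hb).le) t) s =
        H p (if 0 ≤ β t s then g (cone p x (fun b hb => (h b hb).le) (pr (β t s)))
          else K x (pr (-β t s))) (double (min t s)) := by
    intro p x h t s
    have hx : ∀ s, K x s ∈ C p := fun s => KC s x p fun b hb => (h b hb).le
    rcases eq_or_lt_of_le (show 0 ≤ t from t.2.1) with rfl | ht
    · have h1 : β 0 s = -s := by
        simp [hβ, s.2.1]
      have h2 : min 0 s = 0 := min_eq_left s.2.1
      rw [cone_zero, h1, h2, double_zero, neg_neg, prt]
      split_ifs with h3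
      · have h4 : s = 0 := le_antisymm (neg_nonneg.1 h3) s.2.1
        rw [H0 p _ (gC1 _ _ _ _), h4]
        simp only [Set.Icc.coe_zero, neg_zero, pr0, cone_zero]
        exact K0 x
      · rw [H0 p _ (hx s)]
    rcases eq_or_lt_of_le (show t ≤ 1 from t.2.2) with rfl | ht1
    · have h1 : β 1 s = (1 - s) * (1 + 2 * s) := by
        simp [hβ, min_eq_right s.2.2]
      have h2 : min 1 s = s := min_eq_right s.2.2
      have h3 := s.2.1
      have h4 := s.2.2
      have h5 : 0 ≤ β 1 s := by
        rw [h1]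
        exact mul_nonneg (by linarith) (by linarith)
      rw [cone_one, h2, if_pos h5, K1]
      rcases le_total (1 / 2 : ℝ) s with h6 | h6
      -- At the apex the value must not depend on the base: for `s ≥ 1/2` the contraction is
      -- complete, and for `s ≤ 1/2` clamping `β` to 1 already gives `g (vertex p)`.
      · rw [double_of_half_le h6, H1 p _ (gv p), H1 p _ (gC1 _ _ _ _)]
      · rw [pr1, cone_one]
        rw [h1]
        nlinarith
    rw [K2 p x h t ht ht1]
  have Kf : ∀ x, K x 1 = f x := by
    intro x
    induction x using cone_induction with
    | vertex q => rw [K1, double_one, H1 q _ (gv q), f1]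
    | cone q y h t ht ht1 ih =>
      have h2 : min t 1 = t := min_eq_left t.2.2
      have h3 : ∀ s, K y s ∈ C q := fun s => KC s y q fun b hb => (h b hb).le
      have h4 : f y ∈ C q := fC y q fun b hb => (h b hb).le
      rw [K3 q y h, f3 q y h, h2]
      rcases le_or_gt (1 / 2 : ℝ) t with h6 | h6
      · rw [double_of_half_le h6, H1 q _ h4, H1]
        split_ifs
        · exact gC1 _ _ _ _
        · exact h3 _
      · have h0 := t.2.1
        have h1 : β t 1 = -1 - t * (1 - 2 * t) := by
          simp only [hβ, Set.Icc.coe_one, min_eq_left t.2.2]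
          ring
        have h5 : 0 ≤ (t : ℝ) * (1 - 2 * t) := mul_nonneg h0 (by linarith)
        rw [if_neg (by rw [h1]; linarith), pr1 _ (by rw [h1]; linarith), ih]
  have Kcont : Continuous fun w : OrderComplex P × unitInterval => K w.1 w.2 := by
    refine continuous_of_cone (fun p => ?_) fun c p h hc => ?_
    · simp only [K1]
      exact (Hc p).comp_continuous (f := fun s => (g (vertex p), double s))
        (continuous_const.prodMk continuous_double) fun s => ⟨gv p, trivial⟩
    · have hx : ∀ v, ∀ b ∈ (simplex c v).weight.support, b < p := fun v b hb =>
        h b (mem_of_mem_support_simplex hb)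
      simp only [K3 p _ (hx _)]
      dsimp only at hc
      have hts : Continuous fun w : (stdSimplex ℝ c.finset × unitInterval) × unitInterval =>
          (w.1.2, w.2) := (continuous_snd.comp continuous_fst).prodMk continuous_snd
      have hb : Continuous fun w : (stdSimplex ℝ c.finset × unitInterval) × unitInterval =>
          β w.1.2 w.2 := βcont.comp hts
      have hv : Continuous fun w : (stdSimplex ℝ c.finset × unitInterval) × unitInterval =>
          w.1.1 := continuous_fst.comp continuous_fst
      have hp : Continuous fun w : (stdSimplex ℝ c.finset × unitInterval) × unitInterval =>
          (w.1.1, pr (β w.1.2 w.2)) := hv.prodMk (hpr.comp hb)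
      have hn : Continuous fun w : (stdSimplex ℝ c.finset × unitInterval) × unitInterval =>
          (w.1.1, pr (-β w.1.2 w.2)) := hv.prodMk (hpr.comp hb.neg)
      have hg : Continuous fun w : (stdSimplex ℝ c.finset × unitInterval) × unitInterval =>
          g (cone p (simplex c w.1.1) (fun b hb => (hx _ b hb).le) (pr (β w.1.2 w.2))) := by
        have h1 := continuous_cone_simplex fun b hb => (h b hb).le
        have h2 := g.continuous.comp (h1.comp hp)
        simpa only [Function.comp_def] using h2
      have hk : Continuous fun w : (stdSimplex ℝ c.finset × unitInterval) × unitInterval =>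
          K (simplex c w.1.1) (pr (-β w.1.2 w.2)) := by
        have h1 := hc.comp hn
        simpa only [Function.comp_def] using h1
      -- Where `β = 0` both branches equal `g` at the base point.
      have hif := Continuous.if_le hg hk (continuous_const (y := (0 : ℝ))) hb fun w hw => by
        simp only [← hw, neg_zero, pr0, cone_zero, K0]
      have hm := continuous_double.comp (continuous_min.comp hts)
      refine (Hc p).comp_continuous (hif.prodMk hm) fun w => ⟨?_, trivial⟩
      dsimp only
      split_ifs
      · exact gC1 _ _ _ _
      · exact KC _ _ p fun b hb => (hx _ b hb).le
  exact ⟨⟨⟨fun w => K w.2 w.1, Kcont.comp continuous_swap⟩, K0, Kf⟩⟩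

end OrderComplex

/-! ### Subcomplexes -/

namespace OrderComplex

variable {P Q : Type*} [PartialOrder P] [PartialOrder Q]

theorem exists_of_mem_support_map (f : P →o Q) {x : OrderComplex P} {q : Q}
    (h : q ∈ (map f x).weight.support) : ∃ p ∈ x.weight.support, f p = q := by
  classical
  exact Finset.mem_image.1 (Finsupp.mapDomain_support h)

/-- The full subcomplex on a set of vertices. -/
def sub (S : Set P) : Set (OrderComplex P) := {x | ∀ a ∈ x.weight.support, a ∈ S}

theorem sub_mono {S T : Set P} (h : S ⊆ T) : sub S ⊆ sub T := fun _ hx a ha => h (hx a ha)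

/-- The inclusion of a subset of a poset. -/
def incl (S : Set P) : S →o P := ⟨Subtype.val, fun _ _ h => h⟩

theorem map_incl_weight {S : Set P} (x : OrderComplex S) (a : S) :
    (map (incl S) x).weight a = x.weight a :=
  Finsupp.mapDomain_apply Subtype.val_injective _ _

theorem map_incl_mem_sub {S : Set P} (x : OrderComplex S) : map (incl S) x ∈ sub S := by
  intro a ha
  obtain ⟨b, -, rfl⟩ := exists_of_mem_support_map _ ha
  exact b.2

theorem range_map_incl (S : Set P) : Set.range (map (incl S)) = sub S := by
  ext x
  refine ⟨?_, fun hx => ?_⟩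
  · rintro ⟨y, rfl⟩
    exact map_incl_mem_sub y
  · have hs : ∀ a : S, a ∈ (x.weight.subtypeDomain (· ∈ S)).support →
        (a : P) ∈ x.weight.support := fun a ha => by
      rwa [Finsupp.mem_support_iff, Finsupp.subtypeDomain_apply, ← Finsupp.mem_support_iff] at ha
    refine ⟨⟨x.weight.subtypeDomain (· ∈ S), fun a => x.nonneg a, ?_, ?_⟩, ?_⟩
    · exact (Finsupp.sum_subtypeDomain_index (h := fun _ r => r) hx).trans x.sum_eq_one
    · intro a ha b hb hab
      exact x.isChain (hs a ha) (hs b hb) fun h => hab (Subtype.ext h)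
    · apply OrderComplex.ext
      ext a
      by_cases ha : a ∈ S
      · exact map_incl_weight _ ⟨a, ha⟩
      · have h1 : a ∉ x.weight.support := fun h => ha (hx a h)
        rw [Finsupp.notMem_support_iff.1 h1, ← Finsupp.notMem_support_iff]
        exact fun h => ha (map_incl_mem_sub _ a h)

theorem map_incl_injective (S : Set P) : Function.Injective (map (incl S)) := by
  intro x y h
  apply OrderComplex.ext
  ext a
  rw [← map_incl_weight, ← map_incl_weight, h]

theorem isClosed_iff {Z : Set (OrderComplex P)} :
    IsClosed Z ↔ ∀ c : NonemptyFiniteChains P, IsClosed (simplex c ⁻¹' Z) := by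
  rw [isClosed_iSup_iff]
  simp only [isClosed_coinduced]

/-- The trace of the image of a closed set on a simplex is the image of a closed subset of the
compact face spanned by the vertices in `S`. -/
theorem isClosedEmbedding_map_incl (S : Set P) :
    Topology.IsClosedEmbedding (map (incl S)) := by
  classical
  refine Topology.IsClosedEmbedding.of_continuous_injective_isClosedMap (map _).continuous
    (map_incl_injective S) fun Z hZ => isClosed_iff.2 fun c => ?_
  let s : Finset S := c.finset.subtype (· ∈ S)
  have hs : ∀ a : S, a ∈ s ↔ (a : P) ∈ c.finset := fun a => Finset.mem_subtype
  have hsupp : ∀ z : OrderComplex S, (∀ a ∈ (map (incl S) z).weight.support, a ∈ c.finset) →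
      z.weight.support ⊆ s := by
    intro z hz a ha
    refine (hs a).2 (hz a ?_)
    rwa [Finsupp.mem_support_iff, map_incl_weight, ← Finsupp.mem_support_iff]
  rcases s.eq_empty_or_nonempty with h0 | h0
  · convert! isClosed_empty
    rw [Set.eq_empty_iff_forall_notMem]
    rintro v ⟨z, -, hz⟩
    obtain ⟨a, ha⟩ := z.support_nonempty
    have := hsupp z (fun a ha => mem_of_mem_support_simplex (hz ▸ ha)) ha
    rw [h0] at this
    exact Finset.notMem_empty _ this
  · let c' : NonemptyFiniteChains S :=
      ⟨s, h0, fun a b => c.comparable ⟨a.1, (hs _).1 a.2⟩ ⟨b.1, (hs _).1 b.2⟩⟩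
    have hc' : ∀ v : stdSimplex ℝ c'.finset,
        (map (incl S) (simplex c' v)).weight.support ⊆ c.finset := by
      intro v a ha
      obtain ⟨b, hb, rfl⟩ := exists_of_mem_support_map _ ha
      exact (hs b).1 (mem_of_mem_support_simplex hb)
    let u : stdSimplex ℝ c'.finset → stdSimplex ℝ c.finset := fun v => coords c _ (hc' v)
    have hu : Continuous u := by
      refine Continuous.subtype_mk (continuous_pi fun a => ?_) _
      by_cases ha : (a : P) ∈ S
      · exact (continuous_simplex_weight c' ⟨a, ha⟩).congr fun v =>
          (map_incl_weight (simplex c' v) ⟨a, ha⟩).symm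
      · refine continuous_of_const fun v w => ?_
        rw [Finsupp.notMem_support_iff.1 fun h => ha (map_incl_mem_sub (simplex c' v) _ h),
          Finsupp.notMem_support_iff.1 fun h => ha (map_incl_mem_sub (simplex c' w) _ h)]
    have : simplex c ⁻¹' (map (incl S) '' Z) = u '' (simplex c' ⁻¹' Z) := by
      ext v
      constructor
      · rintro ⟨z, hzZ, hz⟩
        have h1 := hsupp z fun a ha => mem_of_mem_support_simplex (hz ▸ ha)
        have h2 : simplex c' (coords c' z h1) = z := simplex_coords c' z h1
        refine ⟨coords c' z h1, ?_, ?_⟩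
        · rw [Set.mem_preimage, h2]
          exact hzZ
        · rw [← coords_simplex c v]
          simp only [u, h2, hz]
      · rintro ⟨w, hw, rfl⟩
        exact ⟨_, hw, (simplex_coords c _ (hc' w)).symm⟩
    rw [this]
    exact hu.isClosedMap _ (hZ.preimage (continuous_simplex c'))

theorem contractibleSpace_sub (S : Set P) [ContractibleSpace (OrderComplex S)] :
    ContractibleSpace (sub S) := by
  rw [← range_map_incl]
  exact (isClosedEmbedding_map_incl S).toIsEmbedding.toHomeomorph.symm.contractibleSpace

/-! ### Contractible posets and homotopies of order-preserving maps -/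

instance contractibleSpace_of_orderTop [OrderTop P] : ContractibleSpace (OrderComplex P) := by
  rw [contractible_iff_id_nullhomotopic]
  refine ⟨vertex ⊤, ⟨⟨⟨fun w => cone ⊤ w.2 (fun _ _ => le_top) w.1, ?_⟩, ?_, ?_⟩⟩⟩
  · have : Continuous fun w : OrderComplex P × unitInterval =>
        cone ⊤ w.1 (fun _ _ => le_top) w.2 :=
      continuous_prod_of_simplex fun c => continuous_cone_simplex fun _ _ => le_top
    have h := this.comp continuous_swap
    simpa only [Function.comp_def, Prod.fst_swap, Prod.snd_swap] using h
  · exact fun x => cone_zero (p := ⊤) (x := x) fun _ _ => le_top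
  · exact fun x => cone_one (p := ⊤) (x := x) fun _ _ => le_top

/-- Both maps are carried by the subcomplexes on `Set.Iic (g p)`, which are contractible because
they have a top vertex. -/
theorem map_homotopic_of_le {f g : P →o Q} (h : f ≤ g) :
    ContinuousMap.Homotopic (map f) (map g) := by
  have hc : ∀ p, ContractibleSpace (sub (Set.Iic (g p))) := fun p => contractibleSpace_sub _
  obtain ⟨k, -, hk⟩ := exists_isCarried (C := fun p => sub (Set.Iic (g p)))
    fun p q hpq => sub_mono (Set.Iic_subset_Iic.2 (g.monotone hpq))
  refine (hk (map f) fun x p hx a ha => ?_).trans (hk (map g) fun x p hx a ha => ?_).symm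
  · obtain ⟨b, hb, rfl⟩ := exists_of_mem_support_map _ ha
    exact (h b).trans (g.monotone (hx b hb))
  · obtain ⟨b, hb, rfl⟩ := exists_of_mem_support_map _ ha
    exact g.monotone (hx b hb)

theorem map_id : map (OrderHom.id : P →o P) = ContinuousMap.id _ := by
  ext x : 1
  apply OrderComplex.ext
  exact Finsupp.mapDomain_id

theorem map_const (q : Q) (x : OrderComplex P) : map (OrderHom.const P q) x = vertex q :=
  eq_vertex fun a ha => by
    obtain ⟨b, -, rfl⟩ := exists_of_mem_support_map _ ha
    exact Finset.mem_singleton_self _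

/-- A conically contractible poset has a contractible realization. -/
theorem contractibleSpace_of_conical (f : P →o P) (q : P) (h1 : ∀ p, p ≤ f p)
    (h2 : ∀ p, q ≤ f p) : ContractibleSpace (OrderComplex P) := by
  rw [contractible_iff_id_nullhomotopic]
  refine ⟨vertex q, ?_⟩
  have h3 := map_homotopic_of_le (f := OrderHom.id) (g := f) h1
  have h4 := map_homotopic_of_le (f := OrderHom.const P q) (g := f) h2
  have h5 : map (OrderHom.const P q) = ContinuousMap.const (OrderComplex P) (vertex q) :=
    ContinuousMap.ext fun x => map_const q x
  rw [map_id] at h3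
  rw [h5] at h4
  exact h3.trans h4.symm

/-- Quillen's fibre lemma. -/
theorem exists_homotopyEquiv_of_fibres (f : P →o Q)
    (hf : ∀ q, ContractibleSpace (OrderComplex {p | f p ≤ q})) :
    ∃ e : ContinuousMap.HomotopyEquiv (OrderComplex P) (OrderComplex Q), e.toFun = map f := by
  have hC : ∀ q, ContractibleSpace (sub {p | f p ≤ q}) := fun q => contractibleSpace_sub _
  have hQ : ∀ q : Q, ContractibleSpace (sub (Set.Iic q)) := fun q => contractibleSpace_sub _
  have hmono : Monotone fun q => sub {p | f p ≤ q} := fun q r hqr =>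
    sub_mono fun p hp => le_trans hp hqr
  -- The homotopy inverse is any map carried by the fibres. Each composite is then carried by the
  -- same contractible subcomplexes as the identity.
  obtain ⟨g, hg, -⟩ := exists_isCarried hmono
  refine ⟨⟨map f, g, ?_, ?_⟩, rfl⟩
  · have hC' : ∀ p, ContractibleSpace (sub {a | f a ≤ f p}) := fun p => hC (f p)
    obtain ⟨k, -, hk⟩ := exists_isCarried (C := fun p => sub {a | f a ≤ f p})
      fun p q hpq => hmono (f.monotone hpq)
    refine (hk _ fun x p hx => ?_).trans (hk _ fun x p hx a ha => ?_).symm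
    · refine hg (map f x) (f p) fun a ha => ?_
      obtain ⟨b, hb, rfl⟩ := exists_of_mem_support_map _ ha
      exact f.monotone (hx b hb)
    · exact f.monotone (hx a ha)
  · obtain ⟨k, -, hk⟩ := exists_isCarried (C := fun q : Q => sub (Set.Iic q))
      fun p q hpq => sub_mono (Set.Iic_subset_Iic.2 hpq)
    refine (hk _ fun x p hx a ha => ?_).trans (hk _ fun x p hx => ?_).symm
    · obtain ⟨b, hb, rfl⟩ := exists_of_mem_support_map _ ha
      exact hg x p hx b hb
    · exact hx

/-- The chains in a subset `S` of a poset. -/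
def chainsIn (S : Set P) : Set (NonemptyFiniteChains P) := {c | ∀ a ∈ c.finset, a ∈ S}

/-- The greatest element of a chain in `S`. -/
def chainsInTop (S : Set P) : chainsIn S →o S where
  toFun c := ⟨c.1.top, c.2 _ c.1.top_mem⟩
  monotone' _ _ h := NonemptyFiniteChains.top_mono h

/-- Quillen's lemma applies to the greatest-element map: its fibre below `p` is conically
contractible through c ⊆ c ∪ {p} ⊇ {p}. -/
theorem contractibleSpace_chainsIn (S : Set P) [ContractibleSpace (OrderComplex S)] :
    ContractibleSpace (OrderComplex (chainsIn S)) := by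
  obtain ⟨e, -⟩ := exists_homotopyEquiv_of_fibres (chainsInTop S) fun p => by
    let F := {c | chainsInTop S c ≤ p}
    have hF : ∀ c : F, ∀ a ∈ c.1.1.finset, a ≤ (p : P) := fun c a ha =>
      (c.1.1.le_top ha).trans c.2
    have mk : ∀ c : NonemptyFiniteChains P, (∀ a ∈ c.finset, a ∈ S ∧ a ≤ (p : P)) →
        ∃ h : c ∈ chainsIn S, (⟨c, h⟩ : chainsIn S) ∈ F := fun c hc =>
      ⟨fun a ha => (hc a ha).1, (hc _ c.top_mem).2⟩
    have hins : ∀ c : F, ∀ a ∈ (insertTop c.1.1 p (hF c)).finset, a ∈ S ∧ a ≤ (p : P) := by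
      intro c a ha
      rcases mem_insertTop.1 ha with rfl | ha
      · exact ⟨p.2, le_rfl⟩
      · exact ⟨c.1.2 a ha, hF c a ha⟩
    let g : F →o F :=
      { toFun := fun c => ⟨⟨insertTop c.1.1 p (hF c), (mk _ (hins c)).1⟩, (mk _ (hins c)).2⟩
        monotone' := fun c d h a ha => (mem_insertTop (h := hF d)).2
          (((mem_insertTop (h := hF c)).1 ha).imp_right fun h2 => h h2) }
    let b : NonemptyFiniteChains P :=
      ⟨{(p : P)}, Finset.singleton_nonempty _, fun x y => by
        rw [Subtype.ext ((Finset.mem_singleton.1 x.2).trans (Finset.mem_singleton.1 y.2).symm)]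
        exact Or.inl le_rfl⟩
    have hb : ∀ a ∈ b.finset, a ∈ S ∧ a ≤ (p : P) := by
      intro a ha
      rw [Finset.mem_singleton.1 ha]
      exact ⟨p.2, le_rfl⟩
    refine contractibleSpace_of_conical g ⟨⟨b, (mk b hb).1⟩, (mk b hb).2⟩
      (fun c a ha => (mem_insertTop (h := hF c)).2 (Or.inr ha))
      fun c a ha => (mem_insertTop (h := hF c)).2 (Or.inl ?_)
    exact Finset.mem_singleton.1 ha
  exact e.contractibleSpace

end OrderComplex

end

theorem theorem3p2 (n : ℕ) :
    ∃ φ : NonemptyFiniteChains (PD n) →o FCD n,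
      (∀ (g : MulAut (FreeGroup (Fin n))) (x : NonemptyFiniteChains (PD n)),
        φ (g • x) = g • φ x) ∧
      ∃ e : ContinuousMap.HomotopyEquiv (OrderComplex (NonemptyFiniteChains (PD n)))
          (OrderComplex (FCD n)),
        e.toFun = OrderComplex.map φ := by
  refine ⟨PD.toFCD n, PD.toFCD_smul, OrderComplex.exists_homotopyEquiv_of_fibres _ fun x => ?_⟩
  obtain ⟨c, hc⟩ := PD.exists_le_gather x
  have := OrderComplex.contractibleSpace_of_conical (PD.gather x) c (PD.le_gather x) hc
  have h : {s | PD.toFCD n s ≤ x} = OrderComplex.chainsIn (PD.fibre x) :=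
    Set.ext fun s => PD.toFCD_le_iff s x
  rw [h]
  exact OrderComplex.contractibleSpace_chainsIn _
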